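/- Let $k$ be an algebraically closed field of characteristic zero and let $A$ be a Hopf algebra over $k$, with comultiplication $\Delta$, counit $\varepsilon$ and antipode $S$. Assume that $A$ is cosemisimple (the category of right $A$-comodules is semisimple, i.e. every subcomodule of a right $A$-comodule is a direct summand as a comodule) and that $S^4=\mathrm{id}_A$. Then $$\mathrm{cd}(A)=\mathrm{cd}_{\mathrm{GS}}(A).$$ Here $$\mathrm{cd}(A)=\sup\{n : H^n(A,M)\neq 0 \text{ for some } A\text{-bimodule } M\}\in\mathbb N\cup\{\infty\}$$ is the Hochschild cohomological dimension of $A$, where $H^n(A,M)=\mathrm{Ext}^n_{A\otimes_k A^{\mathrm{op}}}(A,M)$ is Hochschild cohomology; and $$\mathrm{cd}_{\mathrm{GS}}(A)=\sup\{n : \mathrm{Ext}^n_{\mathcal{YD}_A^A}(k,V)\neq 0 \text{ for some } V\in\mathcal{YD}_A^A\}\in\mathbb N\cup\{\infty\}$$ is the Gerstenhaber-Schack cohomological dimension of $A$, where $\mathcal{YD}_A^A$ is the abelian category of right-right Yetter-Drinfeld modules over $A$: its objects are the right $A$-modules and right $A$-comodules $V$ such that $$(v\cdot a)_{(0)}\otimes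 (v\cdot a)_{(1)} = v_{(0)}\cdot a_{(2)}\otimes S(a_{(1)})\,v_{(1)}\,a_{(3)}\qquad (v\in V,\ a\in A),$$ its morphisms are the $A$-linear and $A$-colinear maps, and $k$ denotes the trivial Yetter-Drinfeld module, with $x\cdot a=\varepsilon(a)x$ and coaction $x\mapsto x\otimes 1$. -/

import Mathlib

open CategoryTheory Limits TensorProduct MulOpposite

universe u

noncomputable section

namespace HopfCD

/-! ### Right comodules and cosemisimplicity -/

/-- A right comodule structure on the vector space `V` over the coalgebra `A`:
a coassociative and counital linear map `V → V ⊗ A`. -/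
class RightComodule (k : Type*) (A : Type*) (V : Type*) [Field k] [AddCommGroup A] [Module k A]
    [Coalgebra k A] [AddCommGroup V] [Module k V] where
  /-- The coaction `v ↦ v₍₀₎ ⊗ v₍₁₎`. -/
  coact : V →ₗ[k] V ⊗[k] A
  /-- `v₍₀₎₍₀₎ ⊗ (v₍₀₎₍₁₎ ⊗ v₍₁₎) = v₍₀₎ ⊗ (v₍₁₎₍₁₎ ⊗ v₍₁₎₍₂₎)`. -/
  coassoc : ∀ x : V, TensorProduct.assoc k V A A (coact.rTensor A (coact x)) =
    (Coalgebra.comul (R := k) (A := A)).lTensor V (coact x)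
  /-- `ε(v₍₁₎) v₍₀₎ = v`. -/
  counit : ∀ x : V, TensorProduct.rid k V
    ((Coalgebra.counit (R := k) (A := A)).lTensor V (coact x)) = x

/-- A linear subspace `W` of a right comodule `V` is a subcomodule if the coaction maps `W` into
(the image in `V ⊗ A` of) `W ⊗ A`. -/
def IsSubcomodule (k : Type*) (A : Type*) {V : Type*} [Field k] [AddCommGroup A] [Module k A]
    [Coalgebra k A] [AddCommGroup V] [Module k V] [RightComodule k A V]
    (W : Submodule k V) : Prop :=
  ∀ w ∈ W, RightComodule.coact (A := A) w ∈ LinearMap.range (W.subtype.rTensor A)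

/-- `A` is cosemisimple: its category of right comodules is semisimple, i.e. every subcomodule
of a right comodule is a direct summand, as a comodule. -/
def IsCosemisimple (k A : Type u) [Field k] [AddCommGroup A] [Module k A] [Coalgebra k A] :
    Prop :=
  ∀ (V : Type u) [AddCommGroup V] [Module k V] [RightComodule k A V] (W : Submodule k V),
    IsSubcomodule k A W → ∃ W' : Submodule k V, IsSubcomodule k A W' ∧ IsCompl W W'

/-! ### Hochschild cohomology -/

section Hochschild

variable (k A : Type u) [Field k] [Ring A] [Algebra k A]

/-- The algebra `A` as an `A`-bimodule, i.e. as a left module over the enveloping algebra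
`A ⊗ Aᵐᵒᵖ`, where `(a ⊗ b) • x = a x b`. -/
def regularBimodule : ModuleCat.{u} (A ⊗[k] Aᵐᵒᵖ) :=
  letI := instModuleTensorProductMop k A
  ModuleCat.of (A ⊗[k] Aᵐᵒᵖ) A

/-- Hochschild cohomology `Hⁿ(A, M)`, for `A`-bimodules `M` (on which the two actions of `k`
agree): the group `Extⁿ(A, M)` in the category of `A`-bimodules. -/
def HochschildCohomology (M : ModuleCat.{u} (A ⊗[k] Aᵐᵒᵖ)) (n : ℕ) : Type u :=
  Abelian.Ext.{u} (regularBimodule k A) M n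

instance (M : ModuleCat.{u} (A ⊗[k] Aᵐᵒᵖ)) (n : ℕ) : AddCommGroup (HochschildCohomology k A M n) :=
  inferInstanceAs (AddCommGroup (Abelian.Ext.{u} (regularBimodule k A) M n))

/-- The Hochschild cohomological dimension of the algebra `A`: the supremum of the `n` with
`Hⁿ(A, M) ≠ 0` for some bimodule `M`. -/
def cd : ℕ∞ :=
  sSup {d : ℕ∞ | ∃ n : ℕ, d = n ∧
    ∃ M : ModuleCat.{u} (A ⊗[k] Aᵐᵒᵖ), Nontrivial (HochschildCohomology k A M n)}

end Hochschild

/-! ### Yetter-Drinfeld modules -/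

section YD

variable (k : Type*) (A : Type*) [Field k] [Ring A] [HopfAlgebra k A]

/-- Right multiplication `v ↦ v · a` on a right `A`-module. -/
def ract (V : Type*) [AddCommGroup V] [Module k V] [Module Aᵐᵒᵖ V] [IsScalarTower k Aᵐᵒᵖ V] :
    A →ₗ[k] Module.End k V :=
  (Algebra.lsmul k k V : Aᵐᵒᵖ →ₐ[k] Module.End k V).toLinearMap ∘ₗ
    (opLinearEquiv k : A ≃ₗ[k] Aᵐᵒᵖ).toLinearMap

/-- The operators `v ⊗ x ↦ (v · b) ⊗ S(a) x c` on `V ⊗ A`, for `a ⊗ (b ⊗ c)` in `A ⊗ (A ⊗ A)`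
(see `twist_tmul`). -/
def twist (V : Type*) [AddCommGroup V] [Module k V] [Module Aᵐᵒᵖ V] [IsScalarTower k Aᵐᵒᵖ V] :
    A ⊗[k] (A ⊗[k] A) →ₗ[k] Module.End k (V ⊗[k] A) :=
  TensorProduct.homTensorHomMap (RingHom.id k) V A V A ∘ₗ
    TensorProduct.map (ract k A V)
      ((AlgHom.mulLeftRight k A).toLinearMap ∘ₗ
        TensorProduct.map (HopfAlgebra.antipode k)
          (opLinearEquiv k : A ≃ₗ[k] Aᵐᵒᵖ).toLinearMap) ∘ₗ
    (TensorProduct.leftComm k A A A).toLinearMap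

variable {k A} in
@[simp]
theorem twist_tmul {V : Type*} [AddCommGroup V] [Module k V] [Module Aᵐᵒᵖ V]
    [IsScalarTower k Aᵐᵒᵖ V] (a b c x : A) (v : V) :
    twist k A V (a ⊗ₜ (b ⊗ₜ c)) (v ⊗ₜ x) =
      (op b • v) ⊗ₜ (HopfAlgebra.antipode k a * x * c) := by
  simp [twist, ract]

/-- A right-right Yetter-Drinfeld module over the Hopf algebra `A`: a right `A`-module and right
`A`-comodule `V` with
`(v · a)₍₀₎ ⊗ (v · a)₍₁₎ = v₍₀₎ · a₍₂₎ ⊗ S(a₍₁₎) v₍₁₎ a₍₃₎`. -/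
class YetterDrinfeld (V : Type*) [AddCommGroup V] [Module k V] [Module Aᵐᵒᵖ V]
    [IsScalarTower k Aᵐᵒᵖ V] extends RightComodule k A V where
  coact_smul : ∀ (v : V) (a : A), coact (op a • v) =
    twist k A V ((Coalgebra.comul (R := k) (A := A)).lTensor A (Coalgebra.comul a)) (coact v)

/-- The coaction of a Yetter-Drinfeld module, with explicit arguments. -/
abbrev coact (V : Type*) [AddCommGroup V] [Module k V] [Module Aᵐᵒᵖ V]
    [IsScalarTower k Aᵐᵒᵖ V] [YetterDrinfeld k A V] : V →ₗ[k] V ⊗[k] A :=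
  RightComodule.coact (A := A)

/-- The map `f ⊗ id_A`, for an `A`-linear map `f`. -/
abbrev tens {V W : Type*} [AddCommGroup V] [Module k V] [Module Aᵐᵒᵖ V]
    [IsScalarTower k Aᵐᵒᵖ V] [AddCommGroup W] [Module k W] [Module Aᵐᵒᵖ W]
    [IsScalarTower k Aᵐᵒᵖ W] (f : V →ₗ[Aᵐᵒᵖ] W) : V ⊗[k] A →ₗ[k] W ⊗[k] A :=
  (f.restrictScalars k).rTensor A

section Tensor

variable {k A}
variable {V W : Type*} [AddCommGroup V] [Module k V] [AddCommGroup W] [Module k W]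

theorem assoc_rTensor (f : V →ₗ[k] W) (z : (V ⊗[k] A) ⊗[k] A) :
    TensorProduct.assoc k W A A ((f.rTensor A).rTensor A z) =
      f.rTensor (A ⊗[k] A) (TensorProduct.assoc k V A A z) := by
  induction z with
  | zero => simp
  | add x y hx hy => simp only [map_add, hx, hy]
  | tmul v x =>
    induction v with
    | zero => simp
    | add x y hx hy => simp only [map_add, add_tmul, hx, hy]
    | tmul v y => simp

theorem rid_lTensor (f : V →ₗ[k] W) (g : A →ₗ[k] k) (z : V ⊗[k] A) :
    TensorProduct.rid k W (g.lTensor W (f.rTensor A z)) =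
      f (TensorProduct.rid k V (g.lTensor V z)) := by
  induction z with
  | zero => simp
  | add x y hx hy => simp only [map_add, hx, hy]
  | tmul v x => simp

theorem lTensor_rTensor {B : Type*} [AddCommGroup B] [Module k B]
    (f : V →ₗ[k] W) (g : A →ₗ[k] B) (z : V ⊗[k] A) :
    g.lTensor W (f.rTensor A z) = f.rTensor B (g.lTensor V z) := by
  induction z with
  | zero => simp
  | add x y hx hy => simp only [map_add, hx, hy]
  | tmul v x => simp

theorem rTensor_rTensor_coact {c : V →ₗ[k] V ⊗[k] A} {d : W →ₗ[k] W ⊗[k] A}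
    (f : V →ₗ[k] W) (hf : ∀ x, d (f x) = f.rTensor A (c x)) (z : V ⊗[k] A) :
    d.rTensor A (f.rTensor A z) = (f.rTensor A).rTensor A (c.rTensor A z) := by
  induction z with
  | zero => simp
  | add x y hx hy => simp only [map_add, hx, hy]
  | tmul v x => simp [hf]

end Tensor

section Transfer

variable {k A}
variable {V W Z : Type*} [AddCommGroup V] [Module k V] [Module Aᵐᵒᵖ V] [IsScalarTower k Aᵐᵒᵖ V]
  [AddCommGroup W] [Module k W] [Module Aᵐᵒᵖ W] [IsScalarTower k Aᵐᵒᵖ W]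
  [AddCommGroup Z] [Module k Z] [Module Aᵐᵒᵖ Z] [IsScalarTower k Aᵐᵒᵖ Z]

theorem tens_twist (f : V →ₗ[Aᵐᵒᵖ] W) (t : A ⊗[k] (A ⊗[k] A)) (z : V ⊗[k] A) :
    tens k A f (twist k A V t z) = twist k A W t (tens k A f z) := by
  induction t with
  | zero => simp
  | add x y hx hy => simp only [map_add, LinearMap.add_apply, hx, hy]
  | tmul a t =>
    induction t with
    | zero => simp
    | add x y hx hy => simp only [tmul_add, map_add, LinearMap.add_apply, hx, hy]
    | tmul b c =>
      induction z with
      | zero => simp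
      | add x y hx hy => simp only [map_add, hx, hy]
      | tmul v x => simp

theorem tens_comp (f : V →ₗ[Aᵐᵒᵖ] W) (g : W →ₗ[Aᵐᵒᵖ] Z) (z : V ⊗[k] A) :
    tens k A g (tens k A f z) = tens k A (g ∘ₗ f) z := by
  induction z with
  | zero => simp
  | add x y hx hy => simp only [map_add, hx, hy]
  | tmul v x => simp

theorem tens_zero : tens k A (0 : V →ₗ[Aᵐᵒᵖ] W) = 0 :=
  LinearMap.rTensor_zero A

theorem tens_add (f g : V →ₗ[Aᵐᵒᵖ] W) : tens k A (f + g) = tens k A f + tens k A g :=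
  LinearMap.rTensor_add A (f.restrictScalars k) (g.restrictScalars k)

theorem tens_neg (f : V →ₗ[Aᵐᵒᵖ] W) : tens k A (-f) = -tens k A f :=
  LinearMap.rTensor_neg (f.restrictScalars k)

theorem tens_sub (f g : V →ₗ[Aᵐᵒᵖ] W) : tens k A (f - g) = tens k A f - tens k A g :=
  LinearMap.rTensor_sub (f.restrictScalars k) (g.restrictScalars k)

theorem tens_nsmul (n : ℕ) (f : V →ₗ[Aᵐᵒᵖ] W) : tens k A (n • f) = n • tens k A f := by
  induction n with
  | zero => simp only [zero_smul, tens_zero]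
  | succ n ih => simp only [succ_nsmul, tens_add, ih]

theorem tens_zsmul (n : ℤ) (f : V →ₗ[Aᵐᵒᵖ] W) : tens k A (n • f) = n • tens k A f := by
  cases n with
  | ofNat n => simp only [Int.ofNat_eq_natCast, natCast_zsmul, tens_nsmul]
  | negSucc n => simp only [negSucc_zsmul, tens_neg, tens_nsmul]

theorem tens_injective {f : V →ₗ[Aᵐᵒᵖ] W} (hf : Function.Injective f) :
    Function.Injective (tens k A f) :=
  Module.Flat.rTensor_preserves_injective_linearMap (M := A) (f.restrictScalars k) hf

/-- The three axioms, at one vector. -/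
structure AxiomsAt (c : V →ₗ[k] V ⊗[k] A) (x : V) : Prop where
  coassoc : TensorProduct.assoc k V A A (c.rTensor A (c x)) =
    (Coalgebra.comul (R := k) (A := A)).lTensor V (c x)
  counit : TensorProduct.rid k V ((Coalgebra.counit (R := k) (A := A)).lTensor V (c x)) = x
  smul : ∀ a : A, c (op a • x) =
    twist k A V ((Coalgebra.comul (R := k) (A := A)).lTensor A (Coalgebra.comul a)) (c x)

theorem AxiomsAt.add {c : V →ₗ[k] V ⊗[k] A} {x y : V} (hx : AxiomsAt c x) (hy : AxiomsAt c y) :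
    AxiomsAt c (x + y) where
  coassoc := by simp only [map_add, hx.coassoc, hy.coassoc]
  counit := by simp only [map_add, hx.counit, hy.counit]
  smul a := by simp only [smul_add, map_add, hx.smul, hy.smul]

theorem axiomsAt_coact [YetterDrinfeld k A V] (x : V) : AxiomsAt (coact k A V) x :=
  ⟨RightComodule.coassoc x, RightComodule.counit x, YetterDrinfeld.coact_smul x⟩

/-- Yetter-Drinfeld modules from the three axioms. -/
abbrev ofAxioms (c : V →ₗ[k] V ⊗[k] A) (h : ∀ x, AxiomsAt c x) : YetterDrinfeld k A V where
  coact := c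
  coassoc x := (h x).coassoc
  counit x := (h x).counit
  coact_smul x := (h x).smul

/-- The axioms pass to images. -/
theorem AxiomsAt.map {c : V →ₗ[k] V ⊗[k] A} {d : W →ₗ[k] W ⊗[k] A}
    (f : V →ₗ[Aᵐᵒᵖ] W) (hf : ∀ x, d (f x) = tens k A f (c x)) {x : V} (hx : AxiomsAt c x) :
    AxiomsAt d (f x) where
  coassoc := by
    rw [hf, rTensor_rTensor_coact (f.restrictScalars k) hf, assoc_rTensor, hx.coassoc,
      lTensor_rTensor]
  counit := by
    rw [hf, rid_lTensor, hx.counit]; rfl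
  smul a := by
    rw [← map_smul, hf, hx.smul, tens_twist, hf]

/-- The axioms pass to subobjects. -/
theorem AxiomsAt.of_injective {c : V →ₗ[k] V ⊗[k] A} {d : W →ₗ[k] W ⊗[k] A}
    {f : V →ₗ[Aᵐᵒᵖ] W} (hi : Function.Injective f) (hf : ∀ x, d (f x) = tens k A f (c x)) {x : V}
    (hx : AxiomsAt d (f x)) : AxiomsAt c x where
  coassoc := by
    have h3 : Function.Injective ((f.restrictScalars k).rTensor (A ⊗[k] A)) :=
      Module.Flat.rTensor_preserves_injective_linearMap (M := A ⊗[k] A) (f.restrictScalars k) hi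
    apply h3
    rw [← assoc_rTensor, ← rTensor_rTensor_coact (f.restrictScalars k) hf, ← lTensor_rTensor,
      ← hf, hx.coassoc]
  counit := by
    apply hi
    have := rid_lTensor (f.restrictScalars k) (Coalgebra.counit (R := k) (A := A)) (c x)
    rw [LinearMap.restrictScalars_apply] at this
    rw [← this, ← hf, hx.counit]
  smul a := by
    apply tens_injective (k := k) hi
    rw [tens_twist, ← hf, ← hf, map_smul, hx.smul]

end Transfer

end YD

/-! ### The category of Yetter-Drinfeld modules -/

section Category

/-- The objects of the category of right-right Yetter-Drinfeld modules over `A`. -/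
structure YDCat (k A : Type u) [Field k] [Ring A] [HopfAlgebra k A] where
  /-- Bundle a Yetter-Drinfeld module. -/
  of ::
  /-- The underlying space. -/
  carrier : Type u
  [addCommGroup : AddCommGroup carrier]
  [module : Module k carrier]
  [moduleOp : Module Aᵐᵒᵖ carrier]
  [isScalarTower : IsScalarTower k Aᵐᵒᵖ carrier]
  [yetterDrinfeld : YetterDrinfeld k A carrier]

attribute [instance] YDCat.addCommGroup YDCat.module YDCat.moduleOp YDCat.isScalarTower
  YDCat.yetterDrinfeld

variable {k A : Type u} [Field k] [Ring A] [HopfAlgebra k A]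

instance : CoeSort (YDCat k A) (Type u) := ⟨YDCat.carrier⟩

namespace YDCat

/-- Morphisms of Yetter-Drinfeld modules: the `A`-linear and `A`-colinear maps. -/
@[ext]
structure Hom (V W : YDCat k A) where
  /-- The underlying `A`-linear map. -/
  lin : V →ₗ[Aᵐᵒᵖ] W
  colinear : ∀ x : V, coact k A W (lin x) = tens k A lin (coact k A V x)

instance : Category.{u} (YDCat k A) where
  Hom V W := Hom V W
  id V := ⟨LinearMap.id, fun x => by
    have : (LinearMap.id : V →ₗ[Aᵐᵒᵖ] V).restrictScalars k = LinearMap.id := rfl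
    simp [tens, this]⟩
  comp f g := ⟨g.lin ∘ₗ f.lin, fun x => by
    rw [← tens_comp, ← f.colinear, ← g.colinear]; rfl⟩

variable {V W Z : YDCat k A}

/-- The `A`-linear map underlying a morphism. -/
abbrev lin (f : V ⟶ W) : V →ₗ[Aᵐᵒᵖ] W := Hom.lin f

theorem colinear (f : V ⟶ W) (x : V) :
    coact k A W (lin f x) = tens k A (lin f) (coact k A V x) := Hom.colinear f x

@[ext]
theorem hom_ext {f g : V ⟶ W} (h : ∀ x, lin f x = lin g x) : f = g :=
  Hom.ext (LinearMap.ext h)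

@[simp] theorem lin_id (V : YDCat k A) : lin (𝟙 V) = LinearMap.id := rfl

@[simp] theorem lin_comp (f : V ⟶ W) (g : W ⟶ Z) : lin (f ≫ g) = lin g ∘ₗ lin f := rfl

/-! #### Additive structure -/

instance : Zero (V ⟶ W) := ⟨⟨0, fun x => by rw [tens_zero]; simp⟩⟩
instance : Add (V ⟶ W) := ⟨fun f g => ⟨lin f + lin g, fun x => by
  rw [tens_add]; simp only [LinearMap.add_apply, map_add, colinear]⟩⟩
instance : Neg (V ⟶ W) := ⟨fun f => ⟨-lin f, fun x => by
  rw [tens_neg]; simp only [LinearMap.neg_apply, map_neg, colinear]⟩⟩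
instance : Sub (V ⟶ W) := ⟨fun f g => ⟨lin f - lin g, fun x => by
  rw [tens_sub]; simp only [LinearMap.sub_apply, map_sub, colinear]⟩⟩
instance : SMul ℕ (V ⟶ W) := ⟨fun n f => ⟨n • lin f, fun x => by
  rw [tens_nsmul]; simp only [LinearMap.smul_apply, map_nsmul, colinear]⟩⟩
instance : SMul ℤ (V ⟶ W) := ⟨fun n f => ⟨n • lin f, fun x => by
  rw [tens_zsmul]; simp only [LinearMap.smul_apply, map_zsmul, colinear]⟩⟩

theorem lin_injective : Function.Injective (lin : (V ⟶ W) → (V →ₗ[Aᵐᵒᵖ] W)) :=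
  fun _ _ h => Hom.ext h

instance : AddCommGroup (V ⟶ W) :=
  lin_injective.addCommGroup lin rfl (fun _ _ => rfl) (fun _ => rfl) (fun _ _ => rfl)
    (fun _ _ => rfl) (fun _ _ => rfl)

@[simp] theorem lin_zero : lin (0 : V ⟶ W) = 0 := rfl

@[simp] theorem lin_add (f g : V ⟶ W) : lin (f + g) = lin f + lin g := rfl

instance : Preadditive (YDCat k A) where
  add_comp _ _ _ f g h := by ext x; simp
  comp_add _ _ _ f g h := by ext x; simp

/-! #### Factorizations -/

/-- Factorization through an injective morphism. -/
def lift (f : V ⟶ W) (hf : Function.Injective (lin f)) (g : Z ⟶ W)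
    (h : LinearMap.range (lin g) ≤ LinearMap.range (lin f)) : Z ⟶ V :=
  let l : Z →ₗ[Aᵐᵒᵖ] V := (LinearEquiv.ofInjective (lin f) hf).symm.toLinearMap ∘ₗ
    (lin g).codRestrict (LinearMap.range (lin f)) (fun x => h ⟨x, rfl⟩)
  have hl : lin f ∘ₗ l = lin g := by
    ext x
    exact congrArg Subtype.val ((LinearEquiv.ofInjective (lin f) hf).apply_symm_apply _)
  ⟨l, fun x => by
    apply tens_injective (k := k) hf
    rw [tens_comp, hl, ← colinear, ← colinear]
    exact congrArg _ (LinearMap.congr_fun hl x)⟩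

theorem lift_comp (f : V ⟶ W) (hf : Function.Injective (lin f)) (g : Z ⟶ W)
    (h : LinearMap.range (lin g) ≤ LinearMap.range (lin f)) : lift f hf g h ≫ f = g := by
  ext x
  exact congrArg Subtype.val ((LinearEquiv.ofInjective (lin f) hf).apply_symm_apply _)

/-- Factorization through a surjective morphism. -/
def desc (f : V ⟶ W) (hf : Function.Surjective (lin f)) (g : V ⟶ Z)
    (h : LinearMap.ker (lin f) ≤ LinearMap.ker (lin g)) : W ⟶ Z :=
  let l : W →ₗ[Aᵐᵒᵖ] Z := (LinearMap.ker (lin f)).liftQ (lin g) h ∘ₗ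
    ((lin f).quotKerEquivOfSurjective hf).symm.toLinearMap
  have hl : l ∘ₗ lin f = lin g := by
    ext x
    have : ((lin f).quotKerEquivOfSurjective hf).symm (lin f x) =
        (LinearMap.ker (lin f)).mkQ x := by
      rw [LinearEquiv.symm_apply_eq]; rfl
    simp [l, this]
  ⟨l, fun y => by
    obtain ⟨x, rfl⟩ := hf y
    rw [colinear f, tens_comp, hl, ← colinear g]
    exact congrArg _ (LinearMap.congr_fun hl x)⟩

theorem comp_desc (f : V ⟶ W) (hf : Function.Surjective (lin f)) (g : V ⟶ Z)
    (h : LinearMap.ker (lin f) ≤ LinearMap.ker (lin g)) : f ≫ desc f hf g h = g := by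
  ext x
  have : ((lin f).quotKerEquivOfSurjective hf).symm (lin f x) =
      (LinearMap.ker (lin f)).mkQ x := by
    rw [LinearEquiv.symm_apply_eq]; rfl
  simp [desc, lin, this]

theorem mono_of_injective (f : V ⟶ W) (hf : Function.Injective (lin f)) : Mono f :=
  ⟨fun g h e => by
    ext x
    exact hf (congrArg (fun t => lin t x) e)⟩

theorem epi_of_surjective (f : V ⟶ W) (hf : Function.Surjective (lin f)) : Epi f :=
  ⟨fun g h e => by
    ext y
    obtain ⟨x, rfl⟩ := hf y
    exact congrArg (fun t => lin t x) e⟩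

/-! #### Kernels -/

/-- The coaction maps the kernel `K` of `f` to `K ⊗ A`. -/
theorem coact_ker_mem (f : V ⟶ W) (x : LinearMap.ker (lin f)) :
    coact k A V x ∈ LinearMap.range (tens k A (LinearMap.ker (lin f)).subtype) := by
  have hex : Function.Exact (((LinearMap.ker (lin f)).subtype).restrictScalars k)
      ((lin f).restrictScalars k) := by
    intro y
    constructor
    · intro hy; exact ⟨⟨y, hy⟩, rfl⟩
    · rintro ⟨z, rfl⟩; exact z.2
  have := Module.Flat.rTensor_exact A hex
  refine (this _).1 ?_
  have h := colinear f x.1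
  rw [show lin f x.1 = 0 from x.2, map_zero] at h
  exact h.symm

/-- The kernel of `f`, with the restricted coaction. -/
def kerCoact (f : V ⟶ W) :
    LinearMap.ker (lin f) →ₗ[k] LinearMap.ker (lin f) ⊗[k] A :=
  (LinearEquiv.ofInjective (tens k A (LinearMap.ker (lin f)).subtype)
      (tens_injective (Submodule.injective_subtype _))).symm.toLinearMap ∘ₗ
    (coact k A V ∘ₗ ((LinearMap.ker (lin f)).subtype.restrictScalars k)).codRestrict _
      (coact_ker_mem f)

theorem kerCoact_spec (f : V ⟶ W) (x : LinearMap.ker (lin f)) :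
    coact k A V ((LinearMap.ker (lin f)).subtype x) =
      tens k A (LinearMap.ker (lin f)).subtype (kerCoact f x) := by
  have h := congrArg Subtype.val ((LinearEquiv.ofInjective
    (tens k A (LinearMap.ker (lin f)).subtype)
      (tens_injective (Submodule.injective_subtype _))).apply_symm_apply
        ⟨coact k A V ((LinearMap.ker (lin f)).subtype x), coact_ker_mem f x⟩)
  exact h.symm

/-- The kernel of a morphism. -/
def ker (f : V ⟶ W) : YDCat k A :=
  letI := ofAxioms (kerCoact f) fun _ =>
    AxiomsAt.of_injective (Submodule.injective_subtype _) (kerCoact_spec f) (axiomsAt_coact _)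
  of (LinearMap.ker (lin f))

/-- The inclusion of the kernel. -/
def kerι (f : V ⟶ W) : ker f ⟶ V :=
  ⟨(LinearMap.ker (lin f)).subtype, kerCoact_spec f⟩

theorem kerι_injective (f : V ⟶ W) : Function.Injective (lin (kerι f)) :=
  Submodule.injective_subtype _

theorem range_kerι (f : V ⟶ W) : LinearMap.range (lin (kerι f)) = LinearMap.ker (lin f) :=
  Submodule.range_subtype _

theorem kerι_comp (f : V ⟶ W) : kerι f ≫ f = 0 := by
  ext x; exact x.2

theorem range_le_of_comp_eq_zero {f : V ⟶ W} {g : Z ⟶ V} (h : g ≫ f = 0) :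
    LinearMap.range (lin g) ≤ LinearMap.ker (lin f) := by
  rintro _ ⟨x, rfl⟩
  exact congrArg (fun t => lin t x) h

/-- An injective morphism whose image is the kernel of `f` is a kernel of `f`. -/
def isLimitOfRange (f : V ⟶ W) (i : Z ⟶ V) (hi : Function.Injective (lin i))
    (hr : LinearMap.range (lin i) = LinearMap.ker (lin f)) (w : i ≫ f = 0) :
    IsLimit (KernelFork.ofι i w) :=
  haveI := mono_of_injective i hi
  KernelFork.IsLimit.ofι' i w fun g hg =>
    ⟨lift i hi g (hr ▸ range_le_of_comp_eq_zero hg), lift_comp _ _ _ _⟩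

instance : HasKernels (YDCat k A) where
  has_limit f := ⟨⟨⟨_, isLimitOfRange f (kerι f) (kerι_injective f) (range_kerι f) (kerι_comp f)⟩⟩⟩

/-! #### Cokernels -/

/-- The induced coaction on the cokernel. -/
def cokerCoact (f : V ⟶ W) :
    (W ⧸ LinearMap.range (lin f)) →ₗ[k] (W ⧸ LinearMap.range (lin f)) ⊗[k] A :=
  ((LinearMap.range (lin f)).restrictScalars k).liftQ
      (tens k A (LinearMap.range (lin f)).mkQ ∘ₗ coact k A W) (by
    rintro _ ⟨x, rfl⟩
    rw [LinearMap.mem_ker, LinearMap.comp_apply, colinear, tens_comp,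
      LinearMap.range_mkQ_comp, tens_zero]
    rfl) ∘ₗ
    (Submodule.Quotient.restrictScalarsEquiv k (LinearMap.range (lin f))).symm.toLinearMap

theorem cokerCoact_spec (f : V ⟶ W) (x : W) :
    cokerCoact f ((LinearMap.range (lin f)).mkQ x) =
      tens k A (LinearMap.range (lin f)).mkQ (coact k A W x) := rfl

/-- The cokernel of a morphism. -/
def coker (f : V ⟶ W) : YDCat k A :=
  letI := ofAxioms (cokerCoact f) fun y => by
    obtain ⟨x, rfl⟩ := Submodule.mkQ_surjective _ y
    exact AxiomsAt.map _ (cokerCoact_spec f) (axiomsAt_coact x)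
  of (W ⧸ LinearMap.range (lin f))

/-- The projection to the cokernel. -/
def cokerπ (f : V ⟶ W) : W ⟶ coker f :=
  ⟨(LinearMap.range (lin f)).mkQ, cokerCoact_spec f⟩

theorem cokerπ_surjective (f : V ⟶ W) : Function.Surjective (lin (cokerπ f)) :=
  Submodule.mkQ_surjective _

theorem ker_cokerπ (f : V ⟶ W) : LinearMap.ker (lin (cokerπ f)) = LinearMap.range (lin f) :=
  Submodule.ker_mkQ _

theorem comp_cokerπ (f : V ⟶ W) : f ≫ cokerπ f = 0 := by
  ext x
  exact LinearMap.congr_fun (LinearMap.range_mkQ_comp (lin f)) x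

/-- A surjective morphism whose kernel is the image of `f` is a cokernel of `f`. -/
def isColimitOfKer (f : V ⟶ W) (p : W ⟶ Z) (hp : Function.Surjective (lin p))
    (hr : LinearMap.ker (lin p) = LinearMap.range (lin f)) (w : f ≫ p = 0) :
    IsColimit (CokernelCofork.ofπ p w) :=
  haveI := epi_of_surjective p hp
  CokernelCofork.IsColimit.ofπ' p w fun g hg =>
    ⟨desc p hp g (hr ▸ range_le_of_comp_eq_zero hg), comp_desc _ _ _ _⟩

instance : HasCokernels (YDCat k A) where
  has_colimit f := ⟨⟨⟨_, isColimitOfKer f (cokerπ f) (cokerπ_surjective f) (ker_cokerπ f)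
    (comp_cokerπ f)⟩⟩⟩

/-! #### Monomorphisms and epimorphisms -/

theorem injective_of_mono (f : V ⟶ W) [Mono f] : Function.Injective (lin f) := by
  have h : kerι f = 0 := by rw [← cancel_mono f, kerι_comp, zero_comp]
  rw [← LinearMap.ker_eq_bot, ← range_kerι, h, lin_zero, LinearMap.range_zero]

theorem surjective_of_epi (f : V ⟶ W) [Epi f] : Function.Surjective (lin f) := by
  have h : cokerπ f = 0 := by rw [← cancel_epi f, comp_cokerπ, comp_zero]
  rw [← LinearMap.range_eq_top, ← ker_cokerπ, h, lin_zero, LinearMap.ker_zero]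

instance : IsNormalMonoCategory (YDCat k A) where
  normalMonoOfMono f _ := ⟨{
    Z := coker f
    g := cokerπ f
    w := comp_cokerπ f
    isLimit := isLimitOfRange _ f (injective_of_mono f) (ker_cokerπ f).symm _ }⟩

instance : IsNormalEpiCategory (YDCat k A) where
  normalEpiOfEpi f _ := ⟨{
    W := ker f
    g := kerι f
    w := kerι_comp f
    isColimit := isColimitOfKer _ f (surjective_of_epi f) (range_kerι f).symm _ }⟩

/-! #### Finite products -/

/-- The zero object. -/
def zero (k A : Type u) [Field k] [Ring A] [HopfAlgebra k A] : YDCat k A :=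
  letI := ofAxioms (k := k) (A := A) (V := PUnit.{u + 1}) 0 fun _ =>
    ⟨by simp, Subsingleton.elim _ _, fun _ => by simp⟩
  of PUnit.{u + 1}

instance : HasZeroObject (YDCat k A) :=
  ⟨zero k A, (IsZero.iff_id_eq_zero _).2 (hom_ext fun _ => rfl)⟩

/-- The coaction on the direct sum. -/
def prodCoact (V W : YDCat k A) : V × W →ₗ[k] (V × W) ⊗[k] A :=
  (tens k A (LinearMap.inl Aᵐᵒᵖ V W) ∘ₗ coact k A V).coprod
    (tens k A (LinearMap.inr Aᵐᵒᵖ V W) ∘ₗ coact k A W)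

theorem prodCoact_inl (x : V) : prodCoact V W (LinearMap.inl Aᵐᵒᵖ V W x) =
    tens k A (LinearMap.inl Aᵐᵒᵖ V W) (coact k A V x) := by
  simp [prodCoact]

theorem prodCoact_inr (x : W) : prodCoact V W (LinearMap.inr Aᵐᵒᵖ V W x) =
    tens k A (LinearMap.inr Aᵐᵒᵖ V W) (coact k A W x) := by
  simp [prodCoact]

/-- The direct sum. -/
def prod (V W : YDCat k A) : YDCat k A :=
  letI := ofAxioms (prodCoact V W) fun x => by
    have := (AxiomsAt.map _ prodCoact_inl (axiomsAt_coact x.1)).add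
      (AxiomsAt.map _ prodCoact_inr (axiomsAt_coact x.2))
    simpa using this
  of (V × W)

/-- The first inclusion. -/
def prodInl (V W : YDCat k A) : V ⟶ prod V W := ⟨LinearMap.inl Aᵐᵒᵖ V W, prodCoact_inl⟩

/-- The second inclusion. -/
def prodInr (V W : YDCat k A) : W ⟶ prod V W := ⟨LinearMap.inr Aᵐᵒᵖ V W, prodCoact_inr⟩

theorem tens_id (z : V ⊗[k] A) : tens k A (LinearMap.id : V →ₗ[Aᵐᵒᵖ] V) z = z :=
  LinearMap.rTensor_id_apply A V z

/-- The first projection. -/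
def prodFst (V W : YDCat k A) : prod V W ⟶ V :=
  ⟨LinearMap.fst Aᵐᵒᵖ V W, fun x => by
    change coact k A V x.1 = tens k A (LinearMap.fst Aᵐᵒᵖ V W)
      (tens k A (LinearMap.inl Aᵐᵒᵖ V W) (coact k A V x.1) +
        tens k A (LinearMap.inr Aᵐᵒᵖ V W) (coact k A W x.2))
    rw [map_add, tens_comp, tens_comp, LinearMap.fst_comp_inl, LinearMap.fst_comp_inr, tens_id,
      tens_zero, LinearMap.zero_apply, add_zero]⟩

/-- The second projection. -/
def prodSnd (V W : YDCat k A) : prod V W ⟶ W :=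
  ⟨LinearMap.snd Aᵐᵒᵖ V W, fun x => by
    change coact k A W x.2 = tens k A (LinearMap.snd Aᵐᵒᵖ V W)
      (tens k A (LinearMap.inl Aᵐᵒᵖ V W) (coact k A V x.1) +
        tens k A (LinearMap.inr Aᵐᵒᵖ V W) (coact k A W x.2))
    rw [map_add, tens_comp, tens_comp, LinearMap.snd_comp_inl, LinearMap.snd_comp_inr, tens_id,
      tens_zero, LinearMap.zero_apply, zero_add]⟩

instance : HasBinaryBiproducts (YDCat k A) where
  has_binary_biproduct V W := hasBinaryBiproduct_of_total
    { pt := prod V W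
      fst := prodFst V W
      snd := prodSnd V W
      inl := prodInl V W
      inr := prodInr V W
      inl_fst := hom_ext fun _ => rfl
      inl_snd := hom_ext fun _ => rfl
      inr_fst := hom_ext fun _ => rfl
      inr_snd := hom_ext fun _ => rfl }
    (hom_ext fun x => Prod.ext (add_zero x.1) (zero_add x.2))

instance : HasFiniteProducts (YDCat k A) := hasFiniteProducts_of_has_binary_and_terminal

instance : Abelian (YDCat k A) where

end YDCat

/-! ### Gerstenhaber-Schack cohomology -/

variable (k A)

/-- The ground field `k`, as the carrier of the trivial Yetter-Drinfeld module. -/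
def Triv (_k _A : Type u) : Type u := _k

instance : AddCommGroup (Triv k A) := inferInstanceAs (AddCommGroup k)

instance : Module k (Triv k A) := inferInstanceAs (Module k k)

/-- The trivial right action `x · a = x ε(a)`. -/
instance : Module Aᵐᵒᵖ (Triv k A) :=
  Module.compHom (Triv k A)
    ((Bialgebra.counitAlgHom k A : A →+* k).fromOpposite fun _ _ => mul_comm _ _)

theorem Triv.op_smul (a : A) (x : Triv k A) :
    op a • x = Coalgebra.counit (R := k) a • x := rfl

instance : IsScalarTower k Aᵐᵒᵖ (Triv k A) where
  smul_assoc c a x := by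
    obtain ⟨a, rfl⟩ := op_surjective a
    rw [← op_smul, Triv.op_smul, Triv.op_smul, map_smul, smul_assoc]

theorem twist_triv (x : Triv k A) (t : A ⊗[k] A) :
    twist k A (Triv k A) ((Coalgebra.comul (R := k) (A := A)).lTensor A t) (x ⊗ₜ 1) =
      x ⊗ₜ LinearMap.mul' k A ((HopfAlgebra.antipode k).rTensor A t) := by
  have key (a : A) (u : A ⊗[k] A) : twist k A (Triv k A) (a ⊗ₜ u) (x ⊗ₜ 1) =
      x ⊗ₜ (HopfAlgebra.antipode k a *
        TensorProduct.lid k A ((Coalgebra.counit (R := k) (A := A)).rTensor A u)) := by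
    induction u with
    | zero => simp
    | add y z hy hz => simp only [tmul_add, map_add, LinearMap.add_apply, hy, hz, mul_add]
    | tmul b c => simp [Triv.op_smul, smul_tmul]
  induction t with
  | zero => simp
  | add y z hy hz => simp only [tmul_add, map_add, LinearMap.add_apply, hy, hz]
  | tmul a b => simp [key]

/-- The trivial coaction `x ↦ x ⊗ 1`. -/
instance : YetterDrinfeld k A (Triv k A) where
  coact := (TensorProduct.mk k (Triv k A) A).flip 1
  coassoc x := by simp [Algebra.TensorProduct.one_def]
  counit x := by simp
  coact_smul x a := by
    change (op a • x) ⊗ₜ[k] (1 : A) = twist k A (Triv k A) _ (x ⊗ₜ 1)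
    rw [twist_triv, HopfAlgebra.mul_antipode_rTensor_comul_apply, Triv.op_smul,
      Algebra.algebraMap_eq_smul_one, smul_tmul]

/-- The trivial Yetter-Drinfeld module. -/
def trivialYD : YDCat k A := YDCat.of (Triv k A)

/-- Gerstenhaber-Schack cohomology `Hⁿ_GS(A, V)`, for Yetter-Drinfeld modules `V`: the group
`Extⁿ(k, V)` in the category of Yetter-Drinfeld modules, where `k` is the trivial one. -/
def GSCohomology (V : YDCat k A) (n : ℕ) : Type (u + 1) :=
  letI := HasExt.standard (YDCat k A)
  Abelian.Ext.{u + 1} (trivialYD k A) V n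

instance (V : YDCat k A) (n : ℕ) : AddCommGroup (GSCohomology k A V n) :=
  letI := HasExt.standard (YDCat k A)
  inferInstanceAs (AddCommGroup (Abelian.Ext.{u + 1} (trivialYD k A) V n))

/-- The Gerstenhaber-Schack cohomological dimension of the Hopf algebra `A`: the supremum of the
`n` with `Hⁿ_GS(A, V) ≠ 0` for some Yetter-Drinfeld module `V`. -/
def cdGS : ℕ∞ :=
  sSup {d : ℕ∞ | ∃ n : ℕ, d = n ∧ ∃ V : YDCat k A, Nontrivial (GSCohomology k A V n)}

end Category

end HopfCD

end

/-!
Tensoring a Yetter-Drinfeld module `V` with `A` gives an exact functor `V ↦ A ⊗ V` to `A`-bimodules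
which sends the trivial module `k` to the regular bimodule `A` and, by the Galois isomorphism
`x ⊗ y ↦ x y₁ ⊗ y₂`, free Yetter-Drinfeld modules to free bimodules. It also reflects projective
objects: a lifting problem of Yetter-Drinfeld modules becomes solvable after applying the functor,
which gives an `A`-linear solution, and averaging that solution against the normalized integral `h`
of `A` makes it colinear. The average is still `A`-linear because `S⁴ = id` forces
`h (x y) = h (y S² x)`. Hence `k` and `A` have the same projective dimension.
-/

noncomputable section

namespace HopfCD

/-! ### Convolution -/

section Convolution

open Coalgebra HopfAlgebra WithConv

variable {R A B : Type*} [CommSemiring R] [Semiring A] [HopfAlgebra R A] [Semiring B] [Algebra R B]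

theorem algHom_convMul_antipode (f : A →ₐ[R] B) :
    toConv f.toLinearMap * toConv (f.toLinearMap ∘ₗ antipode R) = 1 := by
  have h := LinearMap.algHom_comp_convMul_distrib f (toConv LinearMap.id) (toConv (antipode R))
  rw [LinearMap.id_mul_antipode] at h
  refine WithConv.ext (h.symm.trans ?_)
  ext x
  simp [LinearMap.convOne_def]

theorem antipode_convMul_algHom (f : A →ₐ[R] B) :
    toConv (f.toLinearMap ∘ₗ antipode R) * toConv f.toLinearMap = 1 := by
  have h := LinearMap.algHom_comp_convMul_distrib f (toConv (antipode R)) (toConv LinearMap.id)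
  rw [LinearMap.antipode_mul_id] at h
  refine WithConv.ext (h.symm.trans ?_)
  ext x
  simp [LinearMap.convOne_def]

/-- Both sides are convolution inverse to `Δ`. -/
theorem comul_antipode (a : A) : comul (R := R) (antipode R a) =
    TensorProduct.map (antipode R) (antipode R) (TensorProduct.comm R A A (comul a)) := by
  let i₁ : A →ₐ[R] A ⊗[R] A := Algebra.TensorProduct.includeLeft
  let i₂ : A →ₐ[R] A ⊗[R] A := Algebra.TensorProduct.includeRight
  have comul_eq : toConv (comul (R := R) (A := A)) =
      toConv i₁.toLinearMap * toConv i₂.toLinearMap := by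
    ext x
    simp [(ℛ R x).convMul_apply, i₁, i₂, (ℛ R x).eq]
  have map_comm_eq : toConv (TensorProduct.map (antipode R) (antipode R) ∘ₗ
      (TensorProduct.comm R A A).toLinearMap ∘ₗ comul) =
      toConv (i₂.toLinearMap ∘ₗ antipode R) * toConv (i₁.toLinearMap ∘ₗ antipode R) := by
    ext x
    rw [(ℛ R x).convMul_apply]
    simp [i₁, i₂, ← (ℛ R x).eq]
  have right_inv : toConv (comul (R := R) (A := A)) * toConv
      (TensorProduct.map (antipode R) (antipode R) ∘ₗ (TensorProduct.comm R A A).toLinearMap ∘ₗ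
        comul) = 1 := by
    rw [comul_eq, map_comm_eq, mul_assoc, ← mul_assoc (toConv i₂.toLinearMap),
      algHom_convMul_antipode, one_mul, algHom_convMul_antipode]
  exact LinearMap.congr_fun (congrArg ofConv
    (left_inv_eq_right_inv (antipode_convMul_algHom (Bialgebra.comulAlgHom R A)) right_inv)) a

/-- The representation of `Δ(S(a))` induced by one of `Δ(a)`. -/
def reprAntipode {ι : Type*} {a : A} (r : Repr R a ι) : Repr R (antipode R a) ι where
  index := r.index
  left i := antipode R (r.right i)
  right i := antipode R (r.left i)
  eq := by rw [comul_antipode, ← r.eq]; simp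

section Intertwines

variable {C X Y Z : Type*} [AddCommMonoid C] [Module R C]
  [AddCommMonoid X] [Module R X] [AddCommMonoid Y] [Module R Y] [AddCommMonoid Z] [Module R Z]

/-- The linear map `J : X → Y` intertwines two families of operators on `X` and `Y` indexed by
the coalgebra `C`. The families live in convolution algebras, whose product they respect
(see `Intertwines.mul`). -/
def Intertwines (J : X →ₗ[R] Y) (f : WithConv (C →ₗ[R] Module.End R X))
    (g : WithConv (C →ₗ[R] Module.End R Y)) : Prop :=
  ∀ c, J ∘ₗ f.ofConv c = g.ofConv c ∘ₗ J

namespace Intertwines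

variable {J : X →ₗ[R] Y} {f f' : WithConv (C →ₗ[R] Module.End R X)}
  {g g' : WithConv (C →ₗ[R] Module.End R Y)}

theorem apply (h : Intertwines J f g) (c : C) (x : X) : J (f.ofConv c x) = g.ofConv c (J x) :=
  LinearMap.congr_fun (h c) x

theorem comp {K : Y →ₗ[R] Z} {e : WithConv (C →ₗ[R] Module.End R Z)} (hK : Intertwines K g e)
    (hJ : Intertwines J f g) : Intertwines (K ∘ₗ J) f e := fun c => by
  rw [LinearMap.comp_assoc, hJ, ← LinearMap.comp_assoc, hK, LinearMap.comp_assoc]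

variable [Coalgebra R C]

theorem mul (h : Intertwines J f g) (h' : Intertwines J f' g') :
    Intertwines J (f * f') (g * g') := fun c => by
  ext x
  simp [(ℛ R c).convMul_apply, h.apply, h'.apply]

end Intertwines

theorem comp_convMul_congr [Coalgebra R C] {J : X →ₗ[R] Y}
    {f f' : WithConv (C →ₗ[R] Module.End R X)} (h : ∀ c, J ∘ₗ f.ofConv c = J ∘ₗ f'.ofConv c)
    (g : WithConv (C →ₗ[R] Module.End R X)) (c : C) :
    J ∘ₗ (f * g).ofConv c = J ∘ₗ (f' * g).ofConv c := by
  ext x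
  have h' (d : C) (y : X) : J (f.ofConv d y) = J (f'.ofConv d y) := LinearMap.congr_fun (h d) y
  simp [(ℛ R c).convMul_apply, h']

end Intertwines

end Convolution

/-! ### Integrals -/

section Integral

open Coalgebra HopfAlgebra WithConv

/-- A normalized two-sided integral on a Hopf algebra, through left invariance and invariance
under the antipode. -/
structure IsNormalizedIntegral {R A : Type*} [CommSemiring R] [Semiring A] [HopfAlgebra R A]
    (h : A →ₗ[R] R) : Prop where
  one : h 1 = 1
  left : ∀ a : A, TensorProduct.rid R A (h.lTensor A (comul a)) = h a • (1 : A)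
  antipode : ∀ a, h (antipode R a) = h a

section Existence

/-- The right comodule `A`, with the comultiplication as coaction; cosemisimplicity is applied to it
to obtain the integral. -/
abbrev regularComodule (k A : Type*) [Field k] [Ring A] [HopfAlgebra k A] :
    RightComodule k A A where
  coact := comul
  coassoc := coassoc_apply
  counit x := by simp

attribute [local instance] regularComodule

theorem isSubcomodule_span_one (k A : Type*) [Field k] [Ring A] [HopfAlgebra k A] :
    IsSubcomodule k A (Submodule.span k {(1 : A)}) := fun w hw => by
  obtain ⟨c, rfl⟩ := Submodule.mem_span_singleton.1 hw
  refine ⟨(⟨1, Submodule.mem_span_singleton_self 1⟩ : Submodule.span k {(1 : A)}) ⊗ₜ (c • 1), ?_⟩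
  change _ = comul (c • (1 : A))
  simp [Algebra.TensorProduct.one_def]

theorem rTensor_comul_eq_zero_of_isSubcomodule {k A : Type*} [Field k] [Ring A] [HopfAlgebra k A]
    {W : Submodule k A} (hW : IsSubcomodule k A W) {h : A →ₗ[k] k} (hhW : ∀ w ∈ W, h w = 0)
    {w : A} (hw : w ∈ W) : h.rTensor A (comul w) = 0 := by
  obtain ⟨z, hz⟩ := hW w hw
  change W.subtype.rTensor A z = comul w at hz
  have h_comp : h ∘ₗ W.subtype = 0 := LinearMap.ext fun w => hhW _ w.2
  rw [← hz, ← LinearMap.rTensor_comp_apply, h_comp, LinearMap.rTensor_zero, LinearMap.zero_apply]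

theorem exists_right_integral {k A : Type u} [Field k] [Ring A] [HopfAlgebra k A]
    (hA : IsCosemisimple k A) : ∃ h : A →ₗ[k] k, h 1 = 1 ∧
      ∀ a : A, TensorProduct.lid k A (h.rTensor A (comul a)) = h a • (1 : A) := by
  have one_ne_zero : (1 : A) ≠ 0 := fun h0 => by simpa using congrArg (counit (R := k)) h0
  obtain ⟨W, hW, hc⟩ := hA A (Submodule.span k {(1 : A)}) (isSubcomodule_span_one k A)
  let h : A →ₗ[k] k := (LinearEquiv.toSpanNonzeroSingleton k A 1 one_ne_zero).symm.toLinearMap ∘ₗ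
    Submodule.projectionOnto _ _ hc
  have h_one : h 1 = 1 := by
    have := Submodule.projectionOnto_apply_left hc ⟨1, Submodule.mem_span_singleton_self 1⟩
    simp only [h, LinearMap.comp_apply]
    rw [this]
    exact LinearEquiv.coord_self k A 1 one_ne_zero
  have h_compl : ∀ w ∈ W, h w = 0 := fun w hw => by
    simp [h, (Submodule.projectionOnto_apply_eq_zero_iff hc).2 hw]
  refine ⟨h, h_one, fun a => ?_⟩
  obtain ⟨x, hx, w, hw, rfl⟩ := Submodule.mem_sup.1
    (hc.sup_eq_top ▸ Submodule.mem_top : a ∈ Submodule.span k {(1 : A)} ⊔ W)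
  obtain ⟨c, rfl⟩ := Submodule.mem_span_singleton.1 hx
  simp [rTensor_comul_eq_zero_of_isSubcomodule hW h_compl hw, h_compl w hw,
    Algebra.TensorProduct.one_def, h_one]

end Existence

theorem antipode_injective {R A : Type*} [CommSemiring R] [Semiring A] [HopfAlgebra R A]
    (hS : ∀ a : A, antipode R (antipode R (antipode R (antipode R a))) = a) :
    Function.Injective (antipode R (A := A)) := fun a b hab => by
  rw [← hS a, ← hS b, hab]

theorem exists_isNormalizedIntegral {k A : Type u} [Field k] [Ring A] [HopfAlgebra k A]
    (hA : IsCosemisimple k A)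
    (hS : ∀ a : A, antipode k (antipode k (antipode k (antipode k a))) = a) :
    ∃ h : A →ₗ[k] k, IsNormalizedIntegral h := by
  obtain ⟨h, h_one, h_right⟩ := exists_right_integral hA
  have left_comp_antipode (a : A) : TensorProduct.rid k A
      ((h ∘ₗ antipode k).lTensor A (comul a)) = h (antipode k a) • (1 : A) := by
    apply antipode_injective hS
    have := h_right (antipode k a)
    rw [← (reprAntipode (ℛ k a)).eq] at this
    rw [map_smul, antipode_one, ← this, ← (ℛ k a).eq]
    simp [reprAntipode]
  -- A right integral `h` and a left integral `g` satisfy `h(a) g(1) = Σ h(a₁) g(a₂) = h(1) g(a)`.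
  have apply_antipode (a : A) : h (antipode k a) = h a := by
    have e₁ := congrArg (h ∘ₗ antipode k) (h_right a)
    have e₂ := congrArg h (left_comp_antipode a)
    rw [← (ℛ k a).eq] at e₁ e₂
    simp only [map_sum, LinearMap.rTensor_tmul, LinearMap.lTensor_tmul, TensorProduct.lid_tmul,
      TensorProduct.rid_tmul, map_smul, LinearMap.comp_apply, antipode_one, h_one, smul_eq_mul,
      mul_one] at e₁ e₂
    rw [← e₁, ← e₂]
    exact Finset.sum_congr rfl fun _ _ => mul_comm _ _
  refine ⟨h, h_one, fun a => ?_, apply_antipode⟩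
  rw [← apply_antipode a, ← left_comp_antipode a,
    show h ∘ₗ antipode k = h from LinearMap.ext apply_antipode]

namespace IsNormalizedIntegral

variable {R A : Type*} [CommSemiring R] [Semiring A] [HopfAlgebra R A] {h : A →ₗ[R] R}

local notation "S" => HopfAlgebra.antipode R

theorem sum_smul (hh : IsNormalizedIntegral h) {ι : Type*} {a : A}
    (r : Repr R a ι) : ∑ i ∈ r.index, h (r.right i) • r.left i = h a • (1 : A) := by
  simpa [← r.eq] using hh.left a

theorem sum_smul_antipode (hh : IsNormalizedIntegral h) {ι κ : Type*}
    {y z : A} (r : Repr R y ι) (s : Repr R z κ) :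
    ∑ i ∈ r.index, h (r.right i * z) • S (r.left i) =
      ∑ j ∈ s.index, h (y * s.right j) • s.left j := by
  let α : WithConv (A →ₗ[R] A) := toConv (∑ j ∈ s.index,
    (h ∘ₗ LinearMap.mulRight R (s.right j)).smulRight (s.left j))
  let β : WithConv (A →ₗ[R] A) := toConv ((h ∘ₗ LinearMap.mulRight R z).smulRight (1 : A))
  have id_mul : toConv LinearMap.id * α = β := by
    ext x
    rw [(ℛ R x).convMul_apply]
    have := hh.sum_smul ((ℛ R x).mul s)
    simpa [α, β, Repr.mul, Repr.tmul, Repr.induced, Finset.sum_product, Finset.mul_sum] using this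
  have antipode_mul : toConv S * β = α := by
    rw [← id_mul, ← mul_assoc, LinearMap.antipode_mul_id, one_mul]
  have := congrArg (fun f : WithConv (A →ₗ[R] A) => f.ofConv y) antipode_mul
  simp only [r.convMul_apply] at this
  simpa [α, β] using this

theorem sum_smul_left (hh : IsNormalizedIntegral h) (hS : ∀ a : A, S (S (S (S a))) = a)
    {ι κ : Type*} {x w : A} (r : Repr R x ι) (s : Repr R w κ) :
    ∑ i ∈ r.index, h (r.right i * S w) • r.left i =
      ∑ j ∈ s.index, h (x * S (s.left j)) • s.right j := by
  apply antipode_injective hS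
  simpa [reprAntipode] using hh.sum_smul_antipode r (reprAntipode s)

theorem sum_smul_antipode_right (hh : IsNormalizedIntegral h) (hS : ∀ a : A, S (S (S (S a))) = a)
    {ι κ : Type*} {x w : A} (r : Repr R x ι) (s : Repr R w κ) :
    ∑ i ∈ r.index, h (S (r.left i) * w) • S (r.right i) =
      ∑ j ∈ s.index, h (S x * s.right j) • S (S (S (s.left j))) := by
  apply antipode_injective hS
  simpa [reprAntipode, hS] using hh.sum_smul_antipode (reprAntipode r) s

theorem sum_sum_eq_apply_mul_antipode (hh : IsNormalizedIntegral h)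
    (hS : ∀ a : A, S (S (S (S a))) = a) {ι κ : Type*} {x w : A} (r : Repr R x ι) (s : Repr R w κ) :
    ∑ i ∈ r.index, ∑ j ∈ s.index, h (S (r.left i) * s.right j) * h (r.right i * S (s.left j)) =
      h (x * S w) := by
  let α : WithConv (A →ₗ[R] A) := toConv (∑ j ∈ s.index,
    (h ∘ₗ LinearMap.mulRight R (S (s.left j))).smulRight (s.right j))
  let β : WithConv (A →ₗ[R] A) := toConv ((h ∘ₗ LinearMap.mulRight R (S w)).smulRight (1 : A))
  have id_mul : toConv LinearMap.id * β = α := by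
    ext x
    rw [(ℛ R x).convMul_apply]
    simpa [α, β] using hh.sum_smul_left hS (ℛ R x) s
  have antipode_mul : toConv S * α = β := by
    rw [← id_mul, ← mul_assoc, LinearMap.antipode_mul_id, one_mul]
  have := congrArg (fun f : WithConv (A →ₗ[R] A) => h (f.ofConv x)) antipode_mul
  simp only [r.convMul_apply] at this
  simpa [α, β, hh.one, Finset.mul_sum, mul_comm] using this

theorem sum_sum_eq_apply_antipode_mul (hh : IsNormalizedIntegral h)
    (hS : ∀ a : A, S (S (S (S a))) = a) {ι κ : Type*} {x w : A} (r : Repr R x ι) (s : Repr R w κ) :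
    ∑ i ∈ r.index, ∑ j ∈ s.index, h (S (r.left i) * s.right j) * h (r.right i * S (s.left j)) =
      h (S x * w) := by
  let α : WithConv (A →ₗ[R] A) := toConv (∑ i ∈ r.index,
    (h ∘ₗ LinearMap.mulLeft R (S (r.left i))).smulRight (S (r.right i)))
  let β : WithConv (A →ₗ[R] A) := toConv ((h ∘ₗ LinearMap.mulLeft R (S x)).smulRight (1 : A))
  let sq : A →ₐ[R] A := AlgHom.ofLinearMap (S ∘ₗ S) (by simp) (by simp [antipode_mul_antidistrib])
  have cube_mul : toConv (sq.toLinearMap ∘ₗ S) * β = α := by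
    ext w
    rw [(ℛ R w).convMul_apply]
    simpa [α, β, sq] using (hh.sum_smul_antipode_right hS r (ℛ R w)).symm
  have sq_mul : toConv sq.toLinearMap * α = β := by
    rw [← cube_mul, ← mul_assoc, algHom_convMul_antipode, one_mul]
  have := congrArg (fun f : WithConv (A →ₗ[R] A) => h (f.ofConv w)) sq_mul
  simp only [s.convMul_apply] at this
  rw [Finset.sum_comm]
  simp only [← hh.antipode (r.right _ * _), antipode_mul_antidistrib]
  simpa [α, β, sq, hh.one, Finset.mul_sum] using this

theorem apply_mul_antipode (hh : IsNormalizedIntegral h) (hS : ∀ a : A, S (S (S (S a))) = a)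
    (x w : A) : h (x * S w) = h (S x * w) :=
  (hh.sum_sum_eq_apply_mul_antipode hS (ℛ R x) (ℛ R w)).symm.trans
    (hh.sum_sum_eq_apply_antipode_mul hS (ℛ R x) (ℛ R w))

theorem apply_mul_comm (hh : IsNormalizedIntegral h) (hS : ∀ a : A, S (S (S (S a))) = a)
    (x y : A) : h (x * y) = h (y * S (S x)) := by
  have := hh.apply_mul_antipode hS x (S (S (S y)))
  rwa [hS, ← hh.antipode (S x * _), antipode_mul_antidistrib, hS] at this

end IsNormalizedIntegral

end Integral

/-! ### The diagonal operators -/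

section Diag

open Coalgebra HopfAlgebra WithConv

variable {k A : Type*} [Field k] [Ring A] [HopfAlgebra k A]

local notation "S" => HopfAlgebra.antipode k

section Operators

variable (k A)

section Module

variable (V X : Type*) [AddCommGroup V] [Module k V] [Module Aᵐᵒᵖ V] [IsScalarTower k Aᵐᵒᵖ V]
  [AddCommGroup X] [Module k X]

/-- The operators `v ⊗ x ↦ v · a ⊗ x` on `V ⊗ X`. -/
def ractFst : WithConv (A →ₗ[k] Module.End k (V ⊗[k] X)) :=
  toConv (LinearMap.rTensorHom X ∘ₗ ract k A V)

end Module

variable (V : Type*) [AddCommGroup V] [Module k V]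

/-- The operators `v ⊗ x ↦ v ⊗ S(a) x` on `V ⊗ A`. -/
def antipodeMul : WithConv (A →ₗ[k] Module.End k (V ⊗[k] A)) :=
  toConv (LinearMap.lTensorHom V ∘ₗ LinearMap.mul k A ∘ₗ S)

/-- The operators `v ⊗ x ↦ v ⊗ x a` on `V ⊗ A`. -/
def mulRight : WithConv (A →ₗ[k] Module.End k (V ⊗[k] A)) :=
  toConv (LinearMap.lTensorHom V ∘ₗ (LinearMap.mul k A).flip)

/-- The operators `v ⊗ (x ⊗ y) ↦ v ⊗ (a x ⊗ y)` on `V ⊗ (A ⊗ A)`. -/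
def mulFst : A →ₐ[k] Module.End k (V ⊗[k] (A ⊗[k] A)) :=
  (Module.End.lTensorAlgHom k (A ⊗[k] A) V).comp
    ((Module.End.rTensorAlgHom k A A).comp (Algebra.lmul k A))

variable {k A V} in
@[simp]
theorem mulFst_tmul (a x y : A) (v : V) :
    mulFst k A V a (v ⊗ₜ (x ⊗ₜ y)) = v ⊗ₜ ((a * x) ⊗ₜ y) := rfl

/-- The operators `v ⊗ (x ⊗ y) ↦ v ⊗ (S(a) x ⊗ y)` on `V ⊗ (A ⊗ A)`. -/
def antipodeMulFst : WithConv (A →ₗ[k] Module.End k (V ⊗[k] (A ⊗[k] A))) :=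
  toConv ((mulFst k A V).toLinearMap ∘ₗ S)

/-- The operators `v ⊗ (x ⊗ y) ↦ v ⊗ (x ⊗ S(a) y)` on `V ⊗ (A ⊗ A)`. -/
def antipodeMulSnd : WithConv (A →ₗ[k] Module.End k (V ⊗[k] (A ⊗[k] A))) :=
  toConv (LinearMap.lTensorHom V ∘ₗ LinearMap.lTensorHom A ∘ₗ LinearMap.mul k A ∘ₗ S)

/-- The operators `v ⊗ (x ⊗ y) ↦ v ⊗ (x a ⊗ y)` on `V ⊗ (A ⊗ A)`. -/
def mulRightFst : WithConv (A →ₗ[k] Module.End k (V ⊗[k] (A ⊗[k] A))) :=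
  toConv (LinearMap.lTensorHom V ∘ₗ LinearMap.rTensorHom A ∘ₗ (LinearMap.mul k A).flip)

/-- The operators `v ⊗ (x ⊗ y) ↦ v ⊗ (x ⊗ y a)` on `V ⊗ (A ⊗ A)`. -/
def mulRightSnd : WithConv (A →ₗ[k] Module.End k (V ⊗[k] (A ⊗[k] A))) :=
  toConv (LinearMap.lTensorHom V ∘ₗ LinearMap.lTensorHom A ∘ₗ (LinearMap.mul k A).flip)

variable [Module Aᵐᵒᵖ V] [IsScalarTower k Aᵐᵒᵖ V]

/-- The operators `v ⊗ x ↦ v · a₂ ⊗ S(a₁) x a₃` on `V ⊗ A`, which appear in the compatibility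
condition of a Yetter-Drinfeld module, as a convolution product. -/
def diag : WithConv (A →ₗ[k] Module.End k (V ⊗[k] A)) :=
  antipodeMul k A V * (ractFst k A V A * mulRight k A V)

/-- The operators `v ⊗ (x ⊗ y) ↦ v · a₃ ⊗ (S(a₂) x a₄ ⊗ S(a₁) y a₅)` on `V ⊗ (A ⊗ A)`. -/
def diag₂ : WithConv (A →ₗ[k] Module.End k (V ⊗[k] (A ⊗[k] A))) :=
  antipodeMulSnd k A V * (antipodeMulFst k A V * (ractFst k A V (A ⊗[k] A) *
    (mulRightFst k A V * mulRightSnd k A V)))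

end Operators

variable {V : Type*} [AddCommGroup V] [Module k V] [Module Aᵐᵒᵖ V] [IsScalarTower k Aᵐᵒᵖ V]

theorem twist_comul (a : A) :
    twist k A V ((comul (R := k) (A := A)).lTensor A (comul a)) = (diag k A V).ofConv a := by
  refine TensorProduct.ext' fun v x => ?_
  rw [diag, ← (ℛ k a).eq, (ℛ k a).convMul_apply]
  simp only [map_sum, LinearMap.lTensor_tmul, LinearMap.sum_apply, Module.End.mul_apply]
  refine Finset.sum_congr rfl fun i _ => ?_
  rw [← (ℛ k ((ℛ k a).right i)).eq, (ℛ k ((ℛ k a).right i)).convMul_apply]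
  simp [tmul_sum, antipodeMul, ractFst, mulRight, ract, mul_assoc]

theorem twist_mul (s t : A ⊗[k] (A ⊗[k] A)) :
    twist k A V (s * t) = twist k A V t * twist k A V s := by
  suffices (LinearMap.mul k _).compr₂ (twist k A V) =
      (LinearMap.mul k _).flip.compl₁₂ (twist k A V) (twist k A V) from
    LinearMap.congr_fun (LinearMap.congr_fun this s) t
  ext a b c a' b' c' v x
  simp [antipode_mul_antidistrib, mul_smul, mul_assoc]

theorem intertwines_tens {W : Type*} [AddCommGroup W] [Module k W] [Module Aᵐᵒᵖ W]
    [IsScalarTower k Aᵐᵒᵖ W] (f : V →ₗ[Aᵐᵒᵖ] W) :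
    Intertwines (tens k A f) (diag k A V) (diag k A W) := fun a => by
  rw [← twist_comul, ← twist_comul]
  exact LinearMap.ext (tens_twist f _)

theorem diag_mul (a b : A) :
    (diag k A V).ofConv (a * b) = (diag k A V).ofConv b * (diag k A V).ofConv a := by
  have map_mul (s t : A ⊗[k] A) : (comul (R := k) (A := A)).lTensor A (s * t) =
      (comul (R := k)).lTensor A s * (comul (R := k)).lTensor A t :=
    map_mul (Algebra.TensorProduct.map (AlgHom.id k A) (Bialgebra.comulAlgHom k A)) s t
  simp only [← twist_comul, ← twist_mul, ← map_mul, Bialgebra.comul_mul]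

theorem diag_one : (diag k A V).ofConv 1 = 1 := by
  rw [← twist_comul]
  refine TensorProduct.ext' fun v x => ?_
  simp [Algebra.TensorProduct.one_def]

theorem intertwines_lTensor_comul :
    Intertwines ((comul (R := k) (A := A)).lTensor V) (diag k A V) (diag₂ k A V) := by
  have left : Intertwines ((comul (R := k) (A := A)).lTensor V) (antipodeMul k A V)
      (antipodeMulSnd k A V * antipodeMulFst k A V) := fun a => TensorProduct.ext' fun v x => by
    have map_antipode (z : A ⊗[k] A) : v ⊗ₜ[k] (comul (R := k) (S a) * z) =
        (antipodeMulSnd k A V * antipodeMulFst k A V).ofConv a (v ⊗ₜ z) := by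
      rw [← (reprAntipode (ℛ k a)).eq, (ℛ k a).convMul_apply]
      induction z with
      | zero => simp
      | add x y hx hy => simp only [mul_add, tmul_add, map_add, hx, hy]
      | tmul x y =>
        simp [reprAntipode, tmul_sum, Finset.sum_mul, antipodeMulSnd, antipodeMulFst]
    simpa [antipodeMul] using map_antipode (comul x)
  have act : Intertwines ((comul (R := k) (A := A)).lTensor V) (ractFst k A V A)
      (ractFst k A V (A ⊗[k] A)) := fun a => TensorProduct.ext' fun v x => by
    simp [ractFst]
  have right : Intertwines ((comul (R := k) (A := A)).lTensor V) (mulRight k A V)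
      (mulRightFst k A V * mulRightSnd k A V) := fun a => TensorProduct.ext' fun v x => by
    have map_right (z : A ⊗[k] A) : v ⊗ₜ[k] (z * comul (R := k) a) =
        (mulRightFst k A V * mulRightSnd k A V).ofConv a (v ⊗ₜ z) := by
      rw [← (ℛ k a).eq, (ℛ k a).convMul_apply]
      induction z with
      | zero => simp
      | add x y hx hy => simp only [add_mul, tmul_add, map_add, hx, hy]
      | tmul x y => simp [tmul_sum, Finset.mul_sum, mulRightFst, mulRightSnd]
    simpa [mulRight] using map_right (comul x)
  have := left.mul (act.mul right)
  rwa [mul_assoc (antipodeMulSnd k A V)] at this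

theorem intertwines_assoc_rTensor {c : V →ₗ[k] V ⊗[k] A}
    (hc : Intertwines c (toConv (ract k A V)) (diag k A V)) :
    Intertwines ((TensorProduct.assoc k V A A).toLinearMap ∘ₗ c.rTensor A) (diag k A V)
      (diag₂ k A V) := by
  have snd (f : A →ₗ[k] A) :
      ((TensorProduct.assoc k V A A).toLinearMap ∘ₗ c.rTensor A) ∘ₗ f.lTensor V =
        (f.lTensor A).lTensor V ∘ₗ (TensorProduct.assoc k V A A).toLinearMap ∘ₗ c.rTensor A := by
    rw [LinearMap.comp_assoc, LinearMap.rTensor_comp_lTensor, ← LinearMap.lTensor_comp_rTensor,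
      LinearMap.lTensor_tensor]
    ext
    simp
  have act : Intertwines ((TensorProduct.assoc k V A A).toLinearMap ∘ₗ c.rTensor A)
      (ractFst k A V A) (antipodeMulFst k A V * (ractFst k A V (A ⊗[k] A) * mulRightFst k A V)) :=
    fun a => TensorProduct.ext' fun v y => by
    have assoc_diag (z : V ⊗[k] A) : TensorProduct.assoc k V A A ((diag k A V).ofConv a z ⊗ₜ y) =
        (antipodeMulFst k A V * (ractFst k A V (A ⊗[k] A) * mulRightFst k A V)).ofConv a
          (TensorProduct.assoc k V A A (z ⊗ₜ y)) := by
      induction z with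
      | zero => simp
      | add x y hx hy => simp only [map_add, add_tmul, hx, hy]
      | tmul v x =>
        simp only [diag, Repr.convMul_apply (ℛ k _)]
        simp [sum_tmul, antipodeMul, mulRight, antipodeMulFst, mulRightFst, ractFst]
    have := hc.apply a v
    simpa [ractFst, this] using assoc_diag (c v)
  have left : Intertwines ((TensorProduct.assoc k V A A).toLinearMap ∘ₗ c.rTensor A)
      (antipodeMul k A V) (antipodeMulSnd k A V) := fun _ => snd _
  have right : Intertwines ((TensorProduct.assoc k V A A).toLinearMap ∘ₗ c.rTensor A)
      (mulRight k A V) (mulRightSnd k A V) := fun _ => snd _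
  simpa only [diag, diag₂, mul_assoc] using left.mul (act.mul right)

theorem intertwines_rid_lTensor_counit :
    Intertwines ((TensorProduct.rid k V).toLinearMap ∘ₗ (counit (R := k) (A := A)).lTensor V)
      (diag k A V) (toConv (ract k A V)) := by
  have left : Intertwines ((TensorProduct.rid k V).toLinearMap ∘ₗ
      (counit (R := k) (A := A)).lTensor V) (antipodeMul k A V) 1 :=
    fun a => TensorProduct.ext' fun v x => by
    simp [antipodeMul, Algebra.algebraMap_eq_smul_one, mul_smul]
  have act : Intertwines ((TensorProduct.rid k V).toLinearMap ∘ₗ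
      (counit (R := k) (A := A)).lTensor V) (ractFst k A V A) (toConv (ract k A V)) :=
    fun a => TensorProduct.ext' fun v x => by
    simp [ractFst]
  have right : Intertwines ((TensorProduct.rid k V).toLinearMap ∘ₗ
      (counit (R := k) (A := A)).lTensor V) (mulRight k A V) 1 :=
    fun a => TensorProduct.ext' fun v x => by
    simp [mulRight, Algebra.algebraMap_eq_smul_one, mul_comm, mul_smul]
  have := left.mul (act.mul right)
  rwa [one_mul, mul_one] at this

end Diag

/-! ### Averaging linear maps between Yetter-Drinfeld modules -/

section Average

open Coalgebra HopfAlgebra WithConv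

variable {k A : Type*} [Field k] [Ring A] [HopfAlgebra k A]
  {V W Z : Type*} [AddCommGroup V] [Module k V] [AddCommGroup W] [Module k W]
  [AddCommGroup Z] [Module k Z]

local notation "S" => HopfAlgebra.antipode k

/-- The map `w ⊗ (x ⊗ y) ↦ h(x S(y)) w`. -/
def contract (h : A →ₗ[k] k) (W : Type*) [AddCommGroup W] [Module k W] :
    W ⊗[k] (A ⊗[k] A) →ₗ[k] W :=
  (TensorProduct.rid k W).toLinearMap ∘ₗ
    (h ∘ₗ LinearMap.mul' k A ∘ₗ (antipode k).lTensor A).lTensor W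

@[simp]
theorem contract_tmul (h : A →ₗ[k] k) (w : W) (x y : A) :
    contract h W (w ⊗ₜ (x ⊗ₜ y)) = h (x * S y) • w := by
  simp [contract]

theorem contract_rTensor (h : A →ₗ[k] k) (e : W →ₗ[k] Z) (z : W ⊗[k] (A ⊗[k] A)) :
    contract h Z (e.rTensor (A ⊗[k] A) z) = e (contract h W z) := by
  suffices contract h Z ∘ₗ e.rTensor (A ⊗[k] A) = e ∘ₗ contract h W from LinearMap.congr_fun this z
  ext
  simp

theorem intertwines_contract [Module Aᵐᵒᵖ W] [IsScalarTower k Aᵐᵒᵖ W] {h : A →ₗ[k] k}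
    (hh : IsNormalizedIntegral h) (hS : ∀ a : A, S (S (S (S a))) = a) :
    Intertwines (contract h W) (diag₂ k A W) (toConv (ract k A W)) := by
  have snd_eq_fst (a : A) : contract h W ∘ₗ (antipodeMulSnd k A W).ofConv a =
      contract h W ∘ₗ (toConv (mulFst k A W).toLinearMap).ofConv a := by
    ext w x y
    simp [antipodeMulSnd, antipode_mul_antidistrib, mul_assoc, hh.apply_mul_comm hS a]
  have act : Intertwines (contract h W) (ractFst k A W (A ⊗[k] A)) (toConv (ract k A W)) :=
    fun a => by
    ext w x y
    simp [ractFst]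
  have right : Intertwines (contract h W) (mulRightFst k A W * mulRightSnd k A W) 1 := fun a => by
    ext w x y
    have cancel : ∑ i ∈ (ℛ k a).index, x * (ℛ k a).left i * S (y * (ℛ k a).right i) =
        counit (R := k) a • (x * S y) := by
      simp only [antipode_mul_antidistrib, mul_assoc, ← Finset.mul_sum]
      simp only [← mul_assoc, ← Finset.sum_mul, sum_mul_antipode_eq_smul]
      simp
    simpa [(ℛ k a).convMul_apply, mulRightFst, mulRightSnd, Finset.sum_smul, mul_smul,
      Algebra.algebraMap_eq_smul_one] using
      congrArg (fun b => h b • w) cancel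
  have diag₂_eq (a : A) : contract h W ∘ₗ (diag₂ k A W).ofConv a = contract h W ∘ₗ
      (ractFst k A W (A ⊗[k] A) * (mulRightFst k A W * mulRightSnd k A W)).ofConv a := by
    rw [diag₂, comp_convMul_congr snd_eq_fst, ← mul_assoc (toConv _), antipodeMulFst,
      algHom_convMul_antipode, one_mul]
  intro a
  have := act.mul right a
  rwa [mul_one, ← diag₂_eq] at this

theorem contract_lTensor_comul {h : A →ₗ[k] k} (hh : IsNormalizedIntegral h)
    (hS : ∀ a : A, S (S (S (S a))) = a) (u : W ⊗[k] A) {ι : Type*} {y : A} (r : Repr k y ι) :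
    contract h (W ⊗[k] A) (TensorProduct.assoc k _ A A
      ((TensorProduct.assoc k W A A).symm ((comul (R := k)).lTensor W u) ⊗ₜ y)) =
      ∑ i ∈ r.index,
        contract h W (TensorProduct.assoc k W A A (u ⊗ₜ r.left i)) ⊗ₜ[k] r.right i := by
  induction u with
  | zero => simp
  | add u u' hu hu' => simp only [map_add, add_tmul, hu, hu', Finset.sum_add_distrib]
  | tmul w x =>
    have := congrArg (TensorProduct.mk k W A w) (hh.sum_smul_left hS (ℛ k x) r)
    rw [LinearMap.lTensor_tmul, ← (ℛ k x).eq]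
    simpa [tmul_sum, sum_tmul, smul_tmul] using this

section Comodule

variable [RightComodule k A V] [RightComodule k A W] [RightComodule k A Z]

/-- The map `W ⊗ A → W`, `w ⊗ y ↦ h(w₁ S(y)) w₀`, which for an integral `h` is a colinear
retraction of the coaction of `W`. -/
def integrate (h : A →ₗ[k] k) (W : Type*) [AddCommGroup W] [Module k W] [RightComodule k A W] :
    W ⊗[k] A →ₗ[k] W :=
  contract h W ∘ₗ (TensorProduct.assoc k W A A).toLinearMap ∘ₗ
    (RightComodule.coact (A := A)).rTensor A

theorem rTensor_coact_coact (v : V) :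
    (RightComodule.coact (A := A)).rTensor A (RightComodule.coact (A := A) v) =
      (TensorProduct.assoc k V A A).symm
        ((comul (R := k)).lTensor V (RightComodule.coact (A := A) v)) := by
  rw [LinearEquiv.eq_symm_apply, RightComodule.coassoc]

theorem integrate_rTensor (h : A →ₗ[k] k) {e : W →ₗ[k] Z} (he : ∀ w,
    RightComodule.coact (A := A) (e w) = e.rTensor A (RightComodule.coact (A := A) w))
    (z : W ⊗[k] A) : integrate h Z (e.rTensor A z) = e (integrate h W z) := by
  simp only [integrate, LinearMap.comp_apply, LinearEquiv.coe_coe]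
  rw [rTensor_rTensor_coact e he, assoc_rTensor, contract_rTensor]

theorem integrate_coact {h : A →ₗ[k] k} (hh : IsNormalizedIntegral h) (w : W) :
    integrate h W (RightComodule.coact (A := A) w) = w := by
  have contract_comul : contract h W ∘ₗ (comul (R := k)).lTensor W =
      (TensorProduct.rid k W).toLinearMap ∘ₗ (counit (R := k)).lTensor W := by
    refine TensorProduct.ext' fun w x => ?_
    rw [contract, LinearMap.comp_assoc, ← LinearMap.lTensor_comp]
    simp [mul_antipode_lTensor_comul_apply, Algebra.algebraMap_eq_smul_one, hh.one]
  rw [integrate, LinearMap.comp_apply, LinearMap.comp_apply, LinearEquiv.coe_coe,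
    RightComodule.coassoc, ← LinearMap.comp_apply, contract_comul]
  exact RightComodule.counit w

theorem coact_integrate {h : A →ₗ[k] k} (hh : IsNormalizedIntegral h)
    (hS : ∀ a : A, S (S (S (S a))) = a) (z : W ⊗[k] A) :
    RightComodule.coact (A := A) (integrate h W z) = (integrate h W).rTensor A
      ((TensorProduct.assoc k W A A).symm ((comul (R := k)).lTensor W z)) := by
  induction z with
  | zero => simp
  | add x y hx hy => simp only [map_add, hx, hy]
  | tmul w y =>
    simp only [integrate, LinearMap.comp_apply, LinearEquiv.coe_coe, LinearMap.rTensor_tmul]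
    rw [← contract_rTensor, ← assoc_rTensor, LinearMap.rTensor_tmul,
      rTensor_coact_coact, contract_lTensor_comul hh hS _ (ℛ k y), LinearMap.lTensor_tmul,
      ← (ℛ k y).eq]
    simp [tmul_sum]

end Comodule

variable [Module Aᵐᵒᵖ V] [IsScalarTower k Aᵐᵒᵖ V] [YetterDrinfeld k A V]
  [Module Aᵐᵒᵖ W] [IsScalarTower k Aᵐᵒᵖ W] [YetterDrinfeld k A W]

theorem intertwines_coact :
    Intertwines (coact k A V) (toConv (ract k A V)) (diag k A V) := fun a => by
  ext v
  rw [← twist_comul]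
  exact YetterDrinfeld.coact_smul v a

theorem intertwines_integrate {h : A →ₗ[k] k} (hh : IsNormalizedIntegral h)
    (hS : ∀ a : A, S (S (S (S a))) = a) :
    Intertwines (integrate h W) (diag k A W) (toConv (ract k A W)) :=
  (intertwines_contract hh hS).comp (intertwines_assoc_rTensor intertwines_coact)

/-- The average `v ↦ f(v₀)₀ h(f(v₀)₁ S(v₁))` of a linear map `f`. -/
def average (h : A →ₗ[k] k) (f : V →ₗ[k] W) : V →ₗ[k] W :=
  integrate h W ∘ₗ f.rTensor A ∘ₗ coact k A V

theorem average_comp [Module Aᵐᵒᵖ Z] [IsScalarTower k Aᵐᵒᵖ Z] [YetterDrinfeld k A Z]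
    (h : A →ₗ[k] k) {e : W →ₗ[k] Z} (he : ∀ w, coact k A Z (e w) = e.rTensor A (coact k A W w))
    (f : V →ₗ[k] W) : average h (e ∘ₗ f) = e ∘ₗ average h f := by
  ext v
  simp only [average, LinearMap.comp_apply, LinearMap.rTensor_comp]
  exact integrate_rTensor h he _

section Integral

variable {h : A →ₗ[k] k} (hh : IsNormalizedIntegral h)
include hh

theorem average_of_colinear {f : V →ₗ[k] W}
    (hf : ∀ v, coact k A W (f v) = f.rTensor A (coact k A V v)) : average h f = f := by
  ext v
  rw [average, LinearMap.comp_apply, LinearMap.comp_apply, ← hf, integrate_coact hh]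

variable (hS : ∀ a : A, antipode k (antipode k (antipode k (antipode k a))) = a)
include hS

theorem coact_average (f : V →ₗ[k] W) (v : V) :
    coact k A W (average h f v) = (average h f).rTensor A (coact k A V v) := by
  have assoc_symm_rTensor (z : V ⊗[k] (A ⊗[k] A)) :
      (TensorProduct.assoc k W A A).symm (f.rTensor (A ⊗[k] A) z) =
        (f.rTensor A).rTensor A ((TensorProduct.assoc k V A A).symm z) := by
    rw [LinearEquiv.symm_apply_eq, assoc_rTensor, LinearEquiv.apply_symm_apply]
  simp only [average, LinearMap.comp_apply, LinearMap.rTensor_comp]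
  rw [coact_integrate hh hS, lTensor_rTensor, assoc_symm_rTensor, rTensor_coact_coact]

theorem average_smul (f : V →ₗ[Aᵐᵒᵖ] W) (v : V) (a : A) :
    average h (f.restrictScalars k) (op a • v) = op a • average h (f.restrictScalars k) v :=
  (((intertwines_integrate hh hS).comp (intertwines_tens f)).comp intertwines_coact).apply a v

end Integral

end Average

/-! ### Free Yetter-Drinfeld modules -/

section Free

open Coalgebra HopfAlgebra WithConv

/-- The carrier `V ⊗ A` of the free Yetter-Drinfeld module on a comodule `V`. It is a type synonym
because its Yetter-Drinfeld coaction differs from the comodule structures `V ⊗ A` carries. -/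
def FreeYD (k A V : Type*) [Field k] [Ring A] [Algebra k A] [AddCommGroup V] [Module k V] :=
  V ⊗[k] A

section Module

variable (k A V : Type*) [Field k] [Ring A] [Algebra k A] [AddCommGroup V] [Module k V]

instance : AddCommGroup (FreeYD k A V) := inferInstanceAs (AddCommGroup (V ⊗[k] A))

instance : Module k (FreeYD k A V) := inferInstanceAs (Module k (V ⊗[k] A))

/-- Right multiplication on the second factor, `(v ⊗ x) · a = v ⊗ x a`. -/
def freeAct : Aᵐᵒᵖ →ₐ[k] Module.End k (FreeYD k A V) :=
  (Module.End.lTensorAlgHom k A V).comp (Algebra.lsmul k k A)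

instance : Module Aᵐᵒᵖ (FreeYD k A V) := Module.compHom _ (freeAct k A V).toRingHom

instance : IsScalarTower k Aᵐᵒᵖ (FreeYD k A V) where
  smul_assoc c a x := LinearMap.congr_fun (map_smul (freeAct k A V) c a) x

/-- The inclusion `v ↦ v ⊗ 1` of the generators. -/
def freeIncl : V →ₗ[k] FreeYD k A V := (TensorProduct.mk k V A).flip 1

variable {k A V}

theorem op_smul_freeIncl (a : A) (v : V) :
    op a • freeIncl k A V v = (v ⊗ₜ[k] a : V ⊗[k] A) :=
  congrArg (v ⊗ₜ[k] ·) (one_mul a)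

theorem FreeYD.induction {p : FreeYD k A V → Prop} (zero : p 0)
    (smul : ∀ (a : A) (v : V), p (op a • freeIncl k A V v))
    (add : ∀ x y, p x → p y → p (x + y)) (x : FreeYD k A V) : p x :=
  TensorProduct.induction_on (motive := p) x zero
    (fun v a => op_smul_freeIncl (k := k) a v ▸ smul a v) add

end Module

section Comodule

variable {k A V : Type*} [Field k] [Ring A] [HopfAlgebra k A] [AddCommGroup V] [Module k V]
  [RightComodule k A V]

variable (k A V) in
/-- The coaction `v ⊗ a ↦ (v₀ ⊗ a₂) ⊗ S(a₁) v₁ a₃`. -/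
def freeCoact : FreeYD k A V →ₗ[k] FreeYD k A V ⊗[k] A :=
  TensorProduct.lift ((diag k A (FreeYD k A V)).ofConv.flip ∘ₗ (freeIncl k A V).rTensor A ∘ₗ
    RightComodule.coact (A := A))

theorem freeCoact_smul_freeIncl (a : A) (v : V) :
    freeCoact k A V (op a • freeIncl k A V v) = (diag k A (FreeYD k A V)).ofConv a
      ((freeIncl k A V).rTensor A (RightComodule.coact (A := A) v)) := by
  rw [op_smul_freeIncl]
  rfl

theorem freeCoact_freeIncl (v : V) : freeCoact k A V (freeIncl k A V v) =
    (freeIncl k A V).rTensor A (RightComodule.coact (A := A) v) := by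
  rw [← one_smul Aᵐᵒᵖ (freeIncl k A V v), ← op_one, freeCoact_smul_freeIncl, diag_one,
    Module.End.one_apply]

theorem intertwines_freeCoact : Intertwines (freeCoact k A V) (toConv (ract k A (FreeYD k A V)))
    (diag k A (FreeYD k A V)) := fun a => by
  ext x
  change freeCoact k A V (op a • x) = (diag k A (FreeYD k A V)).ofConv a (freeCoact k A V x)
  induction x using FreeYD.induction with
  | zero => simp
  | smul b v =>
    rw [← mul_smul, ← op_mul, freeCoact_smul_freeIncl, freeCoact_smul_freeIncl, diag_mul,
      Module.End.mul_apply]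
  | add x y hx hy => rw [smul_add, map_add, map_add, map_add, hx, hy]

theorem freeCoact_coassoc_freeIncl (v : V) :
    TensorProduct.assoc k (FreeYD k A V) A A
        ((freeCoact k A V).rTensor A (freeCoact k A V (freeIncl k A V v))) =
      (comul (R := k)).lTensor (FreeYD k A V) (freeCoact k A V (freeIncl k A V v)) := by
  rw [freeCoact_freeIncl, rTensor_rTensor_coact (freeIncl k A V) freeCoact_freeIncl, assoc_rTensor,
    RightComodule.coassoc, lTensor_rTensor]

theorem axiomsAt_freeCoact (x : FreeYD k A V) : AxiomsAt (freeCoact k A V) x := by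
  induction x using FreeYD.induction with
  | zero => exact ⟨by simp, by simp, fun _ => by simp⟩
  | add x y hx hy => exact hx.add hy
  | smul a v =>
    have smul (b : A) (x : FreeYD k A V) :
        freeCoact k A V (op b • x) = (diag k A (FreeYD k A V)).ofConv b (freeCoact k A V x) :=
      intertwines_freeCoact.apply b x
    have coassoc := (intertwines_assoc_rTensor intertwines_freeCoact).apply a
      (freeCoact k A V (freeIncl k A V v))
    have comul := intertwines_lTensor_comul.apply a (freeCoact k A V (freeIncl k A V v))
    have counit := intertwines_rid_lTensor_counit.apply a (freeCoact k A V (freeIncl k A V v))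
    refine ⟨?_, ?_, fun b => by rw [smul, twist_comul]⟩
    · rw [smul, comul, ← freeCoact_coassoc_freeIncl]
      exact coassoc
    · rw [smul]
      refine counit.trans (congrArg (ract k A (FreeYD k A V) a) ?_)
      simp only [LinearMap.comp_apply, LinearEquiv.coe_coe]
      rw [freeCoact_freeIncl, rid_lTensor, RightComodule.counit]

instance : YetterDrinfeld k A (FreeYD k A V) := ofAxioms (freeCoact k A V) axiomsAt_freeCoact

end Comodule

section Counit

variable {k A V : Type*} [Field k] [Ring A] [HopfAlgebra k A] [AddCommGroup V] [Module k V]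
  [Module Aᵐᵒᵖ V] [IsScalarTower k Aᵐᵒᵖ V]

variable (k A V) in
/-- The underlying `k`-linear map of `freeCounit`. -/
def freeCounitₗ : FreeYD k A V →ₗ[k] V := TensorProduct.lift (ract k A V).flip

theorem freeCounitₗ_smul_freeIncl (a : A) (v : V) :
    freeCounitₗ k A V (op a • freeIncl k A V v) = op a • v := by
  rw [op_smul_freeIncl]
  rfl

variable (k A V) in
/-- The counit `v ⊗ a ↦ v · a` of the free Yetter-Drinfeld module on the underlying comodule. -/
def freeCounit : FreeYD k A V →ₗ[Aᵐᵒᵖ] V where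
  __ := freeCounitₗ k A V
  map_smul' b x := by
    obtain ⟨b, rfl⟩ := op_surjective b
    change freeCounitₗ k A V _ = op b • freeCounitₗ k A V x
    induction x using FreeYD.induction with
    | zero => simp
    | smul a v =>
      rw [← mul_smul, ← op_mul, freeCounitₗ_smul_freeIncl, freeCounitₗ_smul_freeIncl, op_mul,
        mul_smul]
    | add x y hx hy => rw [smul_add, map_add, map_add, smul_add, hx, hy]

theorem freeCounit_freeIncl (v : V) : freeCounit k A V (freeIncl k A V v) = v := by
  rw [← one_smul Aᵐᵒᵖ (freeIncl k A V v), ← op_one]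
  exact (freeCounitₗ_smul_freeIncl 1 v).trans (by simp)

theorem coact_freeCounit [YetterDrinfeld k A V] (x : FreeYD k A V) :
    coact k A V (freeCounit k A V x) =
      tens k A (freeCounit k A V) (coact k A (FreeYD k A V) x) := by
  have counit_comp_incl : (freeCounit k A V).restrictScalars k ∘ₗ freeIncl k A V = LinearMap.id :=
    LinearMap.ext freeCounit_freeIncl
  induction x using FreeYD.induction with
  | zero => simp
  | smul a v =>
    rw [map_smul, freeCounit_freeIncl, YetterDrinfeld.coact_smul, YetterDrinfeld.coact_smul,
      tens_twist]
    congr 1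
    change _ = tens k A (freeCounit k A V) (freeCoact k A V (freeIncl k A V v))
    rw [freeCoact_freeIncl, ← LinearMap.comp_apply, ← LinearMap.rTensor_comp, counit_comp_incl,
      LinearMap.rTensor_id, LinearMap.id_apply]
  | add x y hx hy => simp only [map_add, hx, hy]

end Counit

namespace YDCat

variable {k A : Type u} [Field k] [Ring A] [HopfAlgebra k A]

/-- The free Yetter-Drinfeld module on the underlying comodule of `V`. -/
def free (V : YDCat k A) : YDCat k A := of (FreeYD k A V)

/-- The canonical epimorphism `v ⊗ a ↦ v · a` from the free Yetter-Drinfeld module. -/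
def freeπ (V : YDCat k A) : free V ⟶ V := ⟨freeCounit k A V, coact_freeCounit⟩

theorem freeπ_surjective (V : YDCat k A) : Function.Surjective (lin (freeπ V)) :=
  fun v => ⟨freeIncl k A V v, freeCounit_freeIncl v⟩

end YDCat

end Free

/-! ### The bimodule `A ⊗ V` of a right module `V` -/

section Bimodule

open Coalgebra HopfAlgebra WithConv

section BimoduleHom

variable {k A M N : Type*} [Field k] [Ring A] [Algebra k A] [AddCommGroup M] [AddCommGroup N]
  [Module k M] [Module k N] [Module (A ⊗[k] Aᵐᵒᵖ) M] [Module (A ⊗[k] Aᵐᵒᵖ) N]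

/-- A linear map between bimodules that commutes with the two-sided actions `x ↦ a x b`. -/
def bimoduleHom (f : M →ₗ[k] N)
    (hf : ∀ (a b : A) (x : M), f ((a ⊗ₜ[k] op b) • x) = (a ⊗ₜ[k] op b) • f x) :
    M →ₗ[A ⊗[k] Aᵐᵒᵖ] N where
  __ := f
  map_smul' r x := by
    change f (r • x) = r • f x
    induction r with
    | zero =>
      exact (congrArg f (zero_smul (A ⊗[k] Aᵐᵒᵖ) x)).trans
        (f.map_zero.trans (zero_smul (A ⊗[k] Aᵐᵒᵖ) (f x)).symm)
    | add r s hr hs => simp only [add_smul, map_add, hr, hs]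
    | tmul a b => exact hf a (unop b) x

end BimoduleHom

/-- The carrier `A ⊗ V` of the bimodule of a right module `V`, with
`a · (x ⊗ v) · b = a x b₁ ⊗ v · b₂`. -/
def TensorBimodule (k A V : Type*) [Field k] [Ring A] [Algebra k A] [AddCommGroup V] [Module k V] :=
  A ⊗[k] V

section Carrier

variable {k A V : Type*} [Field k] [Ring A] [Algebra k A] [AddCommGroup V] [Module k V]

instance : AddCommGroup (TensorBimodule k A V) := inferInstanceAs (AddCommGroup (A ⊗[k] V))

instance : Module k (TensorBimodule k A V) := inferInstanceAs (Module k (A ⊗[k] V))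

/-- The pure tensors of the bimodule `A ⊗ V`. -/
def TensorBimodule.mk : A →ₗ[k] V →ₗ[k] TensorBimodule k A V := TensorProduct.mk k A V

theorem TensorBimodule.induction {p : TensorBimodule k A V → Prop} (zero : p 0)
    (mk : ∀ (a : A) (v : V), p (mk a v)) (add : ∀ x y, p x → p y → p (x + y))
    (x : TensorBimodule k A V) : p x :=
  TensorProduct.induction_on (motive := p) x zero mk add

variable (k A V) in
/-- The left action `a · (x ⊗ v) = a x ⊗ v`. -/
def bimoduleLeft : A →ₐ[k] Module.End k (A ⊗[k] V) :=
  (Module.End.rTensorAlgHom k A V).comp (Algebra.lmul k A)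

@[simp]
theorem bimoduleLeft_tmul (a x : A) (v : V) :
    bimoduleLeft k A V a (x ⊗ₜ v) = (a * x) ⊗ₜ v := rfl

end Carrier

section Action

variable (k A V : Type*) [Field k] [Ring A] [HopfAlgebra k A] [AddCommGroup V] [Module k V]
  [Module Aᵐᵒᵖ V] [IsScalarTower k Aᵐᵒᵖ V]

/-- The operators `x ⊗ v ↦ x a ⊗ v · b`, for `a ⊗ b` in `A ⊗ A`. -/
def rightMap : A ⊗[k] A →ₗ[k] Module.End k (A ⊗[k] V) :=
  TensorProduct.homTensorHomMap (RingHom.id k) A V A V ∘ₗ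
    TensorProduct.map (LinearMap.mul k A).flip (ract k A V)

variable {k A V}

@[simp]
theorem rightMap_tmul (a b x : A) (v : V) :
    rightMap k A V (a ⊗ₜ b) (x ⊗ₜ v) = (x * a) ⊗ₜ (op b • v) := by
  simp [rightMap, ract]

theorem rightMap_mul (s t : A ⊗[k] A) :
    rightMap k A V (s * t) = rightMap k A V t * rightMap k A V s := by
  suffices (LinearMap.mul k _).compr₂ (rightMap k A V) =
      (LinearMap.mul k _).flip.compl₁₂ (rightMap k A V) (rightMap k A V) from
    LinearMap.congr_fun (LinearMap.congr_fun this s) t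
  ext
  simp [mul_smul, mul_assoc]

theorem commute_bimoduleLeft_rightMap (a : A) (t : A ⊗[k] A) :
    Commute (bimoduleLeft k A V a) (rightMap k A V t) := by
  suffices LinearMap.mulLeft k (bimoduleLeft k A V a) ∘ₗ rightMap k A V =
      LinearMap.mulRight k (bimoduleLeft k A V a) ∘ₗ rightMap k A V from
    LinearMap.congr_fun this t
  ext
  simp [mul_assoc]

variable (k A V)

/-- The right action `(x ⊗ v) · b = x b₁ ⊗ v · b₂`. -/
def bimoduleRight : Aᵐᵒᵖ →ₐ[k] Module.End k (A ⊗[k] V) :=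
  AlgHom.ofLinearMap (rightMap k A V ∘ₗ comul ∘ₗ (opLinearEquiv k).symm.toLinearMap)
    (TensorProduct.ext' fun x v => by simp [Algebra.TensorProduct.one_def])
    (fun x y => by simp [rightMap_mul])

/-- The two-sided action `a · (x ⊗ v) · b = a x b₁ ⊗ v · b₂`. -/
def bimoduleAct : A ⊗[k] Aᵐᵒᵖ →ₐ[k] Module.End k (A ⊗[k] V) :=
  Algebra.TensorProduct.lift (bimoduleLeft k A V) (bimoduleRight k A V) fun a _ =>
    commute_bimoduleLeft_rightMap a _

instance : Module (A ⊗[k] Aᵐᵒᵖ) (TensorBimodule k A V) :=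
  Module.compHom (A ⊗[k] V) (bimoduleAct k A V).toRingHom

instance : IsScalarTower k (A ⊗[k] Aᵐᵒᵖ) (TensorBimodule k A V) where
  smul_assoc c a x := LinearMap.congr_fun (map_smul (bimoduleAct k A V) c a) x

end Action

namespace TensorBimodule

variable {k A V W : Type*} [Field k] [Ring A] [HopfAlgebra k A]
  [AddCommGroup V] [Module k V] [AddCommGroup W] [Module k W]

/-- The map `id ⊗ f` of a `k`-linear map `f`. -/
def mapₗ (f : V →ₗ[k] W) : TensorBimodule k A V →ₗ[k] TensorBimodule k A W :=
  f.lTensor A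

@[simp]
theorem mapₗ_mk (f : V →ₗ[k] W) (x : A) (v : V) : mapₗ f (mk x v) = mk x (f v) := rfl

variable (k A V) in
/-- The map `ε ⊗ id`. -/
def counitMap : TensorBimodule k A V →ₗ[k] V :=
  (TensorProduct.lid k V).toLinearMap ∘ₗ (counit (R := k) (A := A)).rTensor V

@[simp]
theorem counitMap_mk (x : A) (v : V) : counitMap k A V (mk x v) = counit (R := k) x • v := rfl

variable [Module Aᵐᵒᵖ V] [IsScalarTower k Aᵐᵒᵖ V] [Module Aᵐᵒᵖ W] [IsScalarTower k Aᵐᵒᵖ W]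

theorem smul_mk (a b x : A) (v : V) {ι : Type*} (r : Repr k b ι) :
    (a ⊗ₜ[k] op b) • (mk x v : TensorBimodule k A V) =
      ∑ i ∈ r.index, mk (a * x * r.left i) (op (r.right i) • v) := by
  change bimoduleLeft k A V a (rightMap k A V (comul b) (x ⊗ₜ v)) = _
  rw [← r.eq]
  simp [mul_assoc]
  rfl

/-- The bimodule map `id ⊗ f` of a map `f` of right modules. -/
def map (f : V →ₗ[Aᵐᵒᵖ] W) : TensorBimodule k A V →ₗ[A ⊗[k] Aᵐᵒᵖ] TensorBimodule k A W :=
  bimoduleHom (mapₗ (f.restrictScalars k)) fun a b x => by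
    induction x using TensorBimodule.induction with
    | zero => simp
    | add x y hx hy => simp only [smul_add, map_add, hx, hy]
    | mk x v => simp [smul_mk _ b _ _ (ℛ k b)]

@[simp]
theorem map_mk (f : V →ₗ[Aᵐᵒᵖ] W) (x : A) (v : V) : map (k := k) f (mk x v) = mk x (f v) := rfl

theorem counitMap_map (f : V →ₗ[Aᵐᵒᵖ] W) (x : TensorBimodule k A V) :
    counitMap k A W (map f x) = f (counitMap k A V x) := by
  induction x using TensorBimodule.induction with
  | zero => simp
  | add x y hx hy => simp only [map_add, hx, hy]
  | mk x v => exact ((f.restrictScalars k).map_smul _ v).symm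

theorem sum_counit_smul_op_smul (b : A) (v : V) {ι : Type*} (r : Repr k b ι) :
    ∑ i ∈ r.index, counit (R := k) (r.left i) • op (r.right i) • v = op b • v := by
  have := congrArg ((ract k A V).flip v) (sum_counit_smul r)
  simpa [ract] using this

theorem counitMap_smul (a b : A) (x : TensorBimodule k A V) :
    counitMap k A V ((a ⊗ₜ[k] op b) • x) = counit (R := k) a • op b • counitMap k A V x := by
  induction x using TensorBimodule.induction with
  | zero => simp
  | add x y hx hy => simp only [smul_add, map_add, hx, hy]
  | mk x v =>
    have smul_comm : op b • counit (R := k) x • v = counit (R := k) x • op b • v :=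
      (ract k A V b).map_smul _ v
    rw [smul_mk a b x v (ℛ k b), counitMap_mk, smul_comm, ← sum_counit_smul_op_smul b v (ℛ k b)]
    simp [Finset.smul_sum, smul_smul, mul_assoc]

theorem counitMap_apply_mk (s : TensorBimodule k A V →ₗ[A ⊗[k] Aᵐᵒᵖ] TensorBimodule k A W)
    (x : A) (v : V) :
    counitMap k A W (s (mk x v)) = counit (R := k) x • counitMap k A W (s (mk 1 v)) := by
  have smul_mk_one : (x ⊗ₜ[k] op (1 : A)) • (mk 1 v : TensorBimodule k A V) = mk x v := by
    rw [smul_mk x 1 1 v ⟨{()}, fun _ => 1, fun _ => 1, by simp [Algebra.TensorProduct.one_def]⟩]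
    simp
  rw [← smul_mk_one, map_smul, counitMap_smul, op_one, one_smul]

theorem counitMap_apply_mk_one_smul
    (s : TensorBimodule k A V →ₗ[A ⊗[k] Aᵐᵒᵖ] TensorBimodule k A W) (b : A) (v : V) :
    counitMap k A W (s (mk 1 (op b • v))) = op b • counitMap k A W (s (mk 1 v)) := by
  have := counitMap_smul 1 b (s (mk 1 v))
  rw [Bialgebra.counit_one, one_smul, ← map_smul, smul_mk 1 b 1 v (ℛ k b)] at this
  rw [← this, ← sum_counit_smul_op_smul b v (ℛ k b)]
  simp only [map_sum, mul_one, one_mul, counitMap_apply_mk s ((ℛ k b).left _)]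
  exact Finset.sum_congr rfl fun _ _ =>
    map_smul (counitMap k A W ∘ₗ s.restrictScalars k ∘ₗ mk 1) _ _

/-- The right module map `V → W` that a bimodule map `A ⊗ V → A ⊗ W` induces on the quotients by
the augmentation ideal acting from the left. -/
def descend (s : TensorBimodule k A V →ₗ[A ⊗[k] Aᵐᵒᵖ] TensorBimodule k A W) : V →ₗ[Aᵐᵒᵖ] W where
  toFun v := counitMap k A W (s (mk 1 v))
  map_add' := by simp
  map_smul' b v := counitMap_apply_mk_one_smul s b.unop v

end TensorBimodule

end Bimodule

section Projective

open Coalgebra HopfAlgebra WithConv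

variable {k A : Type*} [Field k] [Ring A] [HopfAlgebra k A]

/-- The map `a ⊗ b ↦ a f(b₁) ⊗ b₂`. -/
def mulComul (f : WithConv (A →ₗ[k] A)) : A ⊗[k] A →ₗ[k] A ⊗[k] A :=
  (LinearMap.mul' k A ∘ₗ f.ofConv.lTensor A).rTensor A ∘ₗ
    (TensorProduct.assoc k A A A).symm.toLinearMap ∘ₗ comul.lTensor A

theorem mulComul_tmul (f : WithConv (A →ₗ[k] A)) (a b : A) {ι : Type*} (r : Repr k b ι) :
    mulComul f (a ⊗ₜ b) = ∑ i ∈ r.index, (a * f.ofConv (r.left i)) ⊗ₜ r.right i := by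
  simp [mulComul, ← r.eq, tmul_sum]

theorem mulComul_tmul_eq_convMul (f : WithConv (A →ₗ[k] A)) (a b : A) :
    mulComul f (a ⊗ₜ b) = a ⊗ₜ 1 *
      (toConv ((Algebra.TensorProduct.includeLeft : A →ₐ[k] A ⊗[k] A).toLinearMap ∘ₗ f.ofConv) *
        toConv (Algebra.TensorProduct.includeRight : A →ₐ[k] A ⊗[k] A).toLinearMap).ofConv b := by
  simp [mulComul_tmul f a b (ℛ k b), (ℛ k b).convMul_apply, Finset.mul_sum]

theorem mulComul_mul (f g : WithConv (A →ₗ[k] A)) :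
    mulComul (f * g) = mulComul g ∘ₗ mulComul f := by
  refine TensorProduct.ext' fun a b => ?_
  rw [mulComul_tmul_eq_convMul, LinearMap.algHom_comp_convMul_distrib, toConv_ofConv, mul_assoc,
    LinearMap.comp_apply, mulComul_tmul f a b (ℛ k b), (ℛ k b).convMul_apply]
  simp [mulComul_tmul_eq_convMul, Finset.mul_sum, ← mul_assoc]

theorem mulComul_one : mulComul (1 : WithConv (A →ₗ[k] A)) = LinearMap.id := by
  refine TensorProduct.ext' fun a b => ?_
  have := congrArg (a ⊗ₜ[k] ·) (sum_counit_smul (ℛ k b))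
  simpa [mulComul_tmul 1 a b (ℛ k b), Algebra.algebraMap_eq_smul_one, tmul_sum, smul_tmul]
    using this

variable (k A) in
/-- The canonical isomorphism `a ⊗ b ↦ a b₁ ⊗ b₂` of the Hopf algebra `A`, with inverse
`a ⊗ b ↦ a S(b₁) ⊗ b₂`. -/
def galoisEquiv : A ⊗[k] A ≃ₗ[k] A ⊗[k] A :=
  LinearEquiv.ofLinearMap (mulComul (toConv .id)) (mulComul (toConv (antipode k)))
    (by rw [← mulComul_mul, LinearMap.antipode_mul_id, mulComul_one])
    (by rw [← mulComul_mul, LinearMap.id_mul_antipode, mulComul_one])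

namespace TensorBimodule

variable (k A) (V : Type*) [AddCommGroup V] [Module k V]

/-- The bimodule map `(A ⊗ Aᵐᵒᵖ) ⊗ V → A ⊗ (V ⊗ A)` sending `1 ⊗ v` to `1 ⊗ (v ⊗ 1)`. -/
def ofFree : (A ⊗[k] Aᵐᵒᵖ) ⊗[k] V →ₗ[A ⊗[k] Aᵐᵒᵖ] TensorBimodule k A (FreeYD k A V) :=
  TensorProduct.AlgebraTensorModule.lift
    (LinearMap.toSpanSingleton (A ⊗[k] Aᵐᵒᵖ) (V →ₗ[k] TensorBimodule k A (FreeYD k A V))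
      (mk 1 ∘ₗ freeIncl k A V))

/-- The map `(a ⊗ b) ⊗ v ↦ a b₁ ⊗ (v ⊗ b₂)`. -/
def freeEquiv : (A ⊗[k] Aᵐᵒᵖ) ⊗[k] V ≃ₗ[k] A ⊗[k] (V ⊗[k] A) :=
  TensorProduct.congr (TensorProduct.congr (.refl k A) (opLinearEquiv k).symm ≪≫ₗ galoisEquiv k A)
      (.refl k V) ≪≫ₗ
    TensorProduct.assoc k A A V ≪≫ₗ
    TensorProduct.congr (.refl k A) (TensorProduct.comm k A V)

variable {k A V}

theorem freeEquiv_tmul (a b : A) (v : V) {ι : Type*} (r : Repr k b ι) :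
    freeEquiv k A V ((a ⊗ₜ op b) ⊗ₜ v) = ∑ i ∈ r.index, (a * r.left i) ⊗ₜ (v ⊗ₜ r.right i) := by
  simp [freeEquiv, galoisEquiv, mulComul_tmul _ a b r, sum_tmul]

theorem ofFree_tmul (a b : A) (v : V) : ofFree k A V ((a ⊗ₜ op b) ⊗ₜ v) =
    (freeEquiv k A V ((a ⊗ₜ op b) ⊗ₜ v) : A ⊗[k] (V ⊗[k] A)) := by
  change (a ⊗ₜ[k] op b) • (mk 1 (freeIncl k A V v) : TensorBimodule k A (FreeYD k A V)) = _
  rw [freeEquiv_tmul a b v (ℛ k b), smul_mk a b 1 _ (ℛ k b)]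
  simp only [mul_one, op_smul_freeIncl]
  rfl

theorem ofFree_eq_freeEquiv : ((ofFree k A V).restrictScalars k :
    (A ⊗[k] Aᵐᵒᵖ) ⊗[k] V →ₗ[k] A ⊗[k] (V ⊗[k] A)) = (freeEquiv k A V).toLinearMap := by
  ext a b v
  exact ofFree_tmul a b.unop v

theorem ofFree_bijective : Function.Bijective (ofFree k A V) := by
  have := (freeEquiv k A V).bijective
  rwa [← LinearEquiv.coe_toLinearMap, ← ofFree_eq_freeEquiv] at this

instance projective_free : Module.Projective (A ⊗[k] Aᵐᵒᵖ) (TensorBimodule k A (FreeYD k A V)) :=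
  Module.Projective.of_equiv (LinearEquiv.ofBijective (ofFree k A V) ofFree_bijective)

end TensorBimodule

end Projective

/-! ### The functor `V ↦ A ⊗ V` -/

namespace TensorBimodule

variable {k A V W Z : Type*} [Field k] [Ring A] [HopfAlgebra k A]
  [AddCommGroup V] [Module k V] [Module Aᵐᵒᵖ V] [IsScalarTower k Aᵐᵒᵖ V]
  [AddCommGroup W] [Module k W] [Module Aᵐᵒᵖ W] [IsScalarTower k Aᵐᵒᵖ W]
  [AddCommGroup Z] [Module k Z] [Module Aᵐᵒᵖ Z] [IsScalarTower k Aᵐᵒᵖ Z]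

theorem hom_ext {M : Type*} [AddCommGroup M] [Module (A ⊗[k] Aᵐᵒᵖ) M]
    {f g : TensorBimodule k A V →ₗ[A ⊗[k] Aᵐᵒᵖ] M} (h : ∀ x v, f (mk (k := k) x v) = g (mk x v)) :
    f = g := by
  ext x
  induction x using TensorBimodule.induction with
  | zero => simp
  | add x y hx hy => rw [map_add, map_add, hx, hy]
  | mk x v => exact h x v

theorem map_id : map (k := k) (LinearMap.id : V →ₗ[Aᵐᵒᵖ] V) = LinearMap.id :=
  hom_ext fun _ _ => rfl

theorem map_comp (f : V →ₗ[Aᵐᵒᵖ] W) (g : W →ₗ[Aᵐᵒᵖ] Z) :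
    map (k := k) (g ∘ₗ f) = map (k := k) g ∘ₗ map (k := k) f :=
  hom_ext fun _ _ => rfl

theorem map_add (f g : V →ₗ[Aᵐᵒᵖ] W) : map (k := k) (f + g) = map f + map g :=
  hom_ext fun x _ => _root_.map_add (mk x) _ _

theorem map_exact {f : V →ₗ[Aᵐᵒᵖ] W} {g : W →ₗ[Aᵐᵒᵖ] Z} (h : Function.Exact f g) :
    Function.Exact (map (k := k) f) (map (k := k) g) :=
  Module.Flat.lTensor_exact A (f := f.restrictScalars k) (g := g.restrictScalars k) h

theorem comp_descend {s : TensorBimodule k A V →ₗ[A ⊗[k] Aᵐᵒᵖ] TensorBimodule k A W}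
    {e : W →ₗ[Aᵐᵒᵖ] Z} {f : V →ₗ[Aᵐᵒᵖ] Z} (h : map e ∘ₗ s = map f) : e ∘ₗ descend s = f := by
  ext v
  have := congrArg (counitMap k A Z) (LinearMap.congr_fun h (mk 1 v))
  rw [LinearMap.comp_apply, counitMap_map, map_mk, counitMap_mk, Bialgebra.counit_one,
    one_smul] at this
  exact this

end TensorBimodule

section Trivial

open Coalgebra

variable (k A : Type u) [Field k] [Ring A] [HopfAlgebra k A]

/-- The map `a ⊗ c ↦ c a`. -/
def trivMap : TensorBimodule k A (Triv k A) →ₗ[k] A := (TensorProduct.rid k A).toLinearMap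

variable {k A}

@[simp]
theorem trivMap_mk (a : A) (c : Triv k A) :
    trivMap k A (TensorBimodule.mk a c) = (show k from c) • a := rfl

theorem trivMap_smul (a b : A) (x : TensorBimodule k A (Triv k A)) :
    trivMap k A ((a ⊗ₜ[k] op b) • x) = a * trivMap k A x * b := by
  induction x using TensorBimodule.induction with
  | zero => simp
  | add x y hx hy => rw [smul_add, map_add, map_add, hx, hy, mul_add, add_mul]
  | mk x c =>
    have sum_smul_counit := congrArg (TensorProduct.rid k A) (sum_tmul_counit_eq (ℛ k b))
    simp only [map_sum, TensorProduct.rid_tmul, one_smul] at sum_smul_counit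
    rw [TensorBimodule.smul_mk a b x c (ℛ k b), map_sum]
    conv_rhs => rw [← sum_smul_counit]
    rw [Finset.mul_sum]
    refine Finset.sum_congr rfl fun i _ => ?_
    rw [trivMap_mk, trivMap_mk, Triv.op_smul, mul_smul_comm, mul_smul_comm, smul_mul_assoc,
      smul_smul]
    rfl

variable (k A)

/-- The bimodule of the trivial module is the regular bimodule. -/
def trivEquiv : letI := instModuleTensorProductMop k A
    TensorBimodule k A (Triv k A) ≃ₗ[A ⊗[k] Aᵐᵒᵖ] A :=
  letI := instModuleTensorProductMop k A
  LinearEquiv.ofBijective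
    (bimoduleHom (trivMap k A) fun a b x => (trivMap_smul a b x).trans (mul_assoc _ _ _))
    (TensorProduct.rid k A).bijective

end Trivial

section Functor

variable (k A : Type u) [Field k] [Ring A] [HopfAlgebra k A]

/-- The functor `V ↦ A ⊗ V` from Yetter-Drinfeld modules to bimodules. -/
def bimoduleFunctor : YDCat k A ⥤ ModuleCat.{u} (A ⊗[k] Aᵐᵒᵖ) where
  obj V := ModuleCat.of _ (TensorBimodule k A V)
  map f := ModuleCat.ofHom (TensorBimodule.map (YDCat.lin f))
  map_id _ := congrArg ModuleCat.ofHom TensorBimodule.map_id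
  map_comp _ _ := congrArg ModuleCat.ofHom (TensorBimodule.map_comp _ _)

instance : (bimoduleFunctor k A).Additive where
  map_add {_ _ f g} := congrArg ModuleCat.ofHom
    (TensorBimodule.map_add (k := k) (YDCat.lin f) (YDCat.lin g))

variable {k A}

theorem YDCat.function_exact {X : ShortComplex (YDCat k A)} (hX : X.Exact) :
    Function.Exact (lin X.f) (lin X.g) := by
  refine LinearMap.exact_iff.2 (le_antisymm (fun v hv => ?_) (range_le_of_comp_eq_zero X.zero))
  obtain ⟨B, π, hπ, l, hl⟩ := X.exact_iff_exact_up_to_refinements.1 hX (kerι X.g) (kerι_comp X.g)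
  obtain ⟨b, hb⟩ := surjective_of_epi π (⟨v, hv⟩ : LinearMap.ker (lin X.g))
  refine ⟨lin l b, ?_⟩
  rw [← LinearMap.comp_apply, ← lin_comp, ← hl, lin_comp, LinearMap.comp_apply, hb]
  rfl

instance : (bimoduleFunctor k A).PreservesHomology :=
  ((bimoduleFunctor k A).exact_tfae.out 1 2).1 fun _ hX =>
    (ShortComplex.ShortExact.moduleCat_exact_iff_function_exact _).2
      (TensorBimodule.map_exact (k := k) (YDCat.function_exact hX))

instance projective_bimoduleFunctor_free (V : YDCat k A) :
    Projective ((bimoduleFunctor k A).obj (YDCat.free V)) :=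
  (IsProjective.iff_projective (R := A ⊗[k] Aᵐᵒᵖ) (TensorBimodule k A (FreeYD k A V))).1
    inferInstance

/-- The regular bimodule is the image of the trivial Yetter-Drinfeld module. -/
def bimoduleFunctorTrivial : (bimoduleFunctor k A).obj (trivialYD k A) ≅ regularBimodule k A :=
  letI := instModuleTensorProductMop k A
  (trivEquiv k A).toModuleIso

section Average

variable {h : A →ₗ[k] k} (hh : IsNormalizedIntegral h)
  (hS : ∀ a : A, HopfAlgebra.antipode k (HopfAlgebra.antipode k
    (HopfAlgebra.antipode k (HopfAlgebra.antipode k a))) = a)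

/-- The average of an `A`-linear map, as a morphism of Yetter-Drinfeld modules. -/
def YDCat.averageHom {V W : YDCat k A} (t : V →ₗ[Aᵐᵒᵖ] W) : V ⟶ W where
  lin := { average h (t.restrictScalars k) with
    map_smul' := fun b v => average_smul hh hS t v b.unop }
  colinear := coact_average hh hS (t.restrictScalars k)

theorem YDCat.averageHom_comp {V W Z : YDCat k A} {t : V →ₗ[Aᵐᵒᵖ] W} {e : W ⟶ Z} {f : V ⟶ Z}
    (comp_eq : lin e ∘ₗ t = lin f) : averageHom hh hS t ≫ e = f := by
  have average_eq := average_comp h (e := (lin e).restrictScalars k) (colinear e)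
    (t.restrictScalars k)
  have average_lin := average_of_colinear hh (f := (lin f).restrictScalars k) (colinear f)
  have comp_eq' : (lin e).restrictScalars k ∘ₗ t.restrictScalars k = (lin f).restrictScalars k :=
    congrArg (LinearMap.restrictScalars k) comp_eq
  rw [comp_eq', average_lin] at average_eq
  ext v
  exact (LinearMap.congr_fun average_eq v).symm

include hh hS in
theorem projective_of_projective_bimoduleFunctor (P : YDCat k A)
    [Projective ((bimoduleFunctor k A).obj P)] : Projective P where
  factors {E B} f e _ := by
    let s := Projective.factorThru ((bimoduleFunctor k A).map f) ((bimoduleFunctor k A).map e)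
    have comp_s : TensorBimodule.map (k := k) (YDCat.lin e) ∘ₗ s.hom =
        TensorBimodule.map (YDCat.lin f) :=
      congrArg ModuleCat.Hom.hom (Projective.factorThru_comp
        ((bimoduleFunctor k A).map f) ((bimoduleFunctor k A).map e))
    exact ⟨_, YDCat.averageHom_comp hh hS (TensorBimodule.comp_descend comp_s)⟩

end Average

end Functor

/-! ### Comparison of cohomological dimensions -/

section Dimension

universe w w' v v' u₁ u₂

theorem projective_obj_of_projective {C : Type u₁} [Category.{v} C] {D : Type u₂}
    [Category.{v'} D] {F : C ⥤ D}
    (hp : ∀ X : C, ∃ (P : C) (p : P ⟶ X), Epi p ∧ Projective (F.obj P)) (X : C) [Projective X] :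
    Projective (F.obj X) := by
  obtain ⟨P, p, _, _⟩ := hp X
  have r : Retract X P := ⟨Projective.factorThru (𝟙 _) p, p, Projective.factorThru_comp _ _⟩
  exact (r.map F).projective

variable {C : Type u₁} [Category.{v} C] [Abelian C] {D : Type u₂} [Category.{v'} D] [Abelian D]

theorem hasProjectiveDimensionLT_succ_obj_iff {F : C ⥤ D} [F.Additive] [F.PreservesHomology]
    (hp : ∀ X : C, ∃ (P : C) (p : P ⟶ X), Epi p ∧ Projective (F.obj P))
    (hF : ∀ P, Projective (F.obj P) → Projective P) (n : ℕ) (X : C) :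
    HasProjectiveDimensionLT (F.obj X) (n + 1) ↔ HasProjectiveDimensionLT X (n + 1) := by
  induction n generalizing X with
  | zero =>
    rw [zero_add, ← projective_iff_hasProjectiveDimensionLT_one,
      ← projective_iff_hasProjectiveDimensionLT_one]
    exact ⟨hF X, fun _ => projective_obj_of_projective hp X⟩
  | succ n ih =>
    obtain ⟨P, p, _, hP⟩ := hp X
    have exact_p : (ShortComplex.mk (kernel.ι p) p (kernel.condition p)).ShortExact :=
      { exact := ShortComplex.exact_kernel p }
    have := F.preservesFiniteLimits_of_preservesHomology
    have := F.preservesFiniteColimits_of_preservesHomology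
    have exact_map_p := exact_p.map_of_exact F
    rw [exact_p.hasProjectiveDimensionLT_X₃_iff n (hF P hP), ← ih]
    exact exact_map_p.hasProjectiveDimensionLT_X₃_iff n hP

/-- The largest degree in which `Ext X` is nonzero. It is the projective dimension of `X`, except
that it is `0` rather than `⊥` for a zero object. -/
def cohomologicalDimension [HasExt.{w} C] (X : C) : ℕ∞ :=
  sSup {d : ℕ∞ | ∃ n : ℕ, d = n ∧ ∃ Y : C, Nontrivial (Abelian.Ext.{w} X Y n)}

theorem cohomologicalDimension_le_iff [HasExt.{w} C] (X : C) (n : ℕ) :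
    cohomologicalDimension.{w} X ≤ n ↔ HasProjectiveDimensionLT X (n + 1) := by
  rw [cohomologicalDimension, sSup_le_iff]
  constructor
  · refine fun h => HasProjectiveDimensionLT.mk fun i hi Y e => by_contra fun he => ?_
    have : i ≤ n := by exact_mod_cast h i ⟨i, rfl, Y, ⟨e, 0, he⟩⟩
    omega
  · rintro h _ ⟨i, rfl, Y, hY⟩
    by_contra! hi
    exact not_subsingleton _
      (HasProjectiveDimensionLT.subsingleton X (n + 1) i (by exact_mod_cast hi) Y)

theorem cohomologicalDimension_congr [HasExt.{w} C] [HasExt.{w'} D] {X : C} {Z : D}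
    (h : ∀ n : ℕ, HasProjectiveDimensionLT X (n + 1) ↔ HasProjectiveDimensionLT Z (n + 1)) :
    cohomologicalDimension.{w} X = cohomologicalDimension.{w'} Z := by
  refine eq_of_forall_ge_iff fun c => ?_
  induction c with
  | top => simp only [le_top]
  | coe n => rw [cohomologicalDimension_le_iff, cohomologicalDimension_le_iff, h]

end Dimension

section CohomologicalDimension

variable (k A : Type u) [Field k] [Ring A] [HopfAlgebra k A]

theorem cd_eq_cohomologicalDimension :
    cd k A = cohomologicalDimension.{u} (regularBimodule k A) := rfl

theorem cdGS_eq_cohomologicalDimension :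
    letI := HasExt.standard (YDCat k A)
    cdGS k A = cohomologicalDimension.{u + 1} (trivialYD k A) := rfl

end CohomologicalDimension

end HopfCD

end

theorem theorem6p1_general {k A : Type u} [Field k] [Ring A] [HopfAlgebra k A]
    (hA : HopfCD.IsCosemisimple k A)
    (hS : ∀ a : A, HopfAlgebra.antipode k (HopfAlgebra.antipode k
      (HopfAlgebra.antipode k (HopfAlgebra.antipode k a))) = a) :
    HopfCD.cd k A = HopfCD.cdGS k A := by
  obtain ⟨h, hh⟩ := HopfCD.exists_isNormalizedIntegral hA hS
  let _ := HasExt.standard (HopfCD.YDCat k A)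
  rw [HopfCD.cd_eq_cohomologicalDimension, HopfCD.cdGS_eq_cohomologicalDimension]
  refine HopfCD.cohomologicalDimension_congr fun n => ?_
  have free_cover (V : HopfCD.YDCat k A) : ∃ (P : HopfCD.YDCat k A) (p : P ⟶ V), Epi p ∧
      Projective ((HopfCD.bimoduleFunctor k A).obj P) :=
    ⟨V.free, V.freeπ, HopfCD.YDCat.epi_of_surjective _ V.freeπ_surjective, inferInstance⟩
  rw [← HopfCD.hasProjectiveDimensionLT_succ_obj_iff free_cover
    fun P _ => HopfCD.projective_of_projective_bimoduleFunctor hh hS P]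
  exact ⟨fun _ => hasProjectiveDimensionLT_of_iso HopfCD.bimoduleFunctorTrivial.symm _,
    fun _ => hasProjectiveDimensionLT_of_iso HopfCD.bimoduleFunctorTrivial _⟩

theorem theorem6p1 {k A : Type u} [Field k] [IsAlgClosed k] [CharZero k] [Ring A]
    [HopfAlgebra k A] (hA : HopfCD.IsCosemisimple k A)
    (hS : ∀ a : A, HopfAlgebra.antipode k (HopfAlgebra.antipode k
      (HopfAlgebra.antipode k (HopfAlgebra.antipode k a))) = a) :
    HopfCD.cd k A = HopfCD.cdGS k A :=
  theorem6p1_general hA hS
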